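/- Let $Q$ be a matroid of rank $d$ on $[n]=\{1,\dots,n\}$ that is connected (not a direct sum of two matroids on nonempty ground sets) and paving (every circuit has at least $d$ elements); let $\mathcal B(Q)$ be its set of bases and $\rho_Q$ its rank function. Let $w$ be its corank vector, $w_\lambda=d-\rho_Q(\lambda)$ for $\lambda\in\binom{[n]}{d}$. For a nonempty $B\subset\binom{[n]}{d}$ and a reference basis $\lambda_0\in B$, let $A$ be the $d\times n$ matrix over the polynomial ring $\mathbb C[x_{ij}]$ that is the identity in the columns $\lambda_0$ and has, for $j\notin\lambda_0$, the variable $x_{ij}$ in position $(i,j)$ if exchanging the $i$-th element of $\lambda_0$ for $j$ gives a member of $B$, and $0$ otherwise. Write $A_\lambda$ for the maximal minor of $A$ on the columns $\lambda$, and let $$\mathrm{Gr}(B;\mathbb C)=\operatorname{Spec}\Big(U^{-1}\,\mathbb C[x_{ij}]/\langle A_\lambda:\lambda\notin B\rangle\Big),$$ where $U$ is the multiplicative monoid generated by the $A_\lambda$ with $\lambda\in B$. Up to canonical isomorphism this does not depend on $\lambda_0$. Put $\mathrm{Gr}(Q;\mathbb C)=\mathrm{Gr}(\mathcal B(Q);\mathbb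 C)$, the matroid stratum of $Q$ (it is empty if $Q$ is not realizable over $\mathbb C$). The cells of the regular subdivision of the hypersimplex $\Delta(d,n)$ induced by $w$ are the convex hulls of the indicator vectors $\epsilon_\lambda$, $\lambda\in B_v$, where, for $v\in(\mathbb R^n)^\vee$, $B_v$ is the set of all $\lambda\in\binom{[n]}{d}$ that minimize $\langle\epsilon_\lambda,v\rangle+w_\lambda$. They form a poset under the face relation, and $\mathcal B(Q)=B_0$ is the set of vertices of a cell. If $B'\subset B$ belong to a cell and one of its faces, there is a face morphism $\mathrm{Gr}(B;\mathbb C)\to\mathrm{Gr}(B';\mathbb C)$, which pulls back each quotient $A_\lambda/A_\mu$ with $\lambda,\mu\in B'$ to the same quotient on $\mathrm{Gr}(B;\mathbb C)$. Let $\mathrm{Gr}(w)$ be the inverse limit of the schemes $\mathrm{Gr}(B;\mathbb C)$ over all cells, along the face morphisms, and let $\varphi_Q:\mathrm{Gr}(w)\to\mathrm{Gr}(Q;\mathbb C)$ be its structural morphism to the stratum of $Q$. Then $\varphi_Q$ is smooth and surjective, with connected fibers, and $$\dim\mathrm{Gr}(w)=\dim\mathrm{Gr}(Q;\mathbb C)+\sum_{\eta}\big(|\eta|-d+1\big),$$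 where $\eta$ runs over the cyclic hyperplanes of $Q$, that is, the flats $\eta$ of rank $d-1$ such that the restriction of $Q$ to $\eta$ has no coloops. (The empty scheme has dimension $-\infty$.) -/

import Mathlib

open CategoryTheory CategoryTheory.Limits AlgebraicGeometry

noncomputable section

namespace MatroidStrata

/-! ### Systems of `d`-subsets of an `n`-element set and their faces -/

/-- A nonempty set of `d`-element subsets of `Fin n`, for instance the set of bases of a matroid of
rank `d` on `Fin n`. -/
@[ext]
structure BaseSystem (d n : ℕ) where
  carrier : Set (Finset (Fin n))
  card_eq : ∀ l ∈ carrier, l.card = d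
  nonempty : carrier.Nonempty

/-- Base systems are ordered by inclusion. -/
instance {d n : ℕ} : PartialOrder (BaseSystem d n) :=
  PartialOrder.lift BaseSystem.carrier (fun _ _ h => BaseSystem.ext h)

instance {d n : ℕ} : Finite (BaseSystem d n) :=
  Finite.of_injective BaseSystem.carrier (fun _ _ h => BaseSystem.ext h)

/-- The set of entries of the sequence `c` is a member of `B`. Since all members of `B` have `d`
elements, such a sequence lists the elements of a member of `B` in some order. -/
def BaseSystem.Mem {d n : ℕ} (B : BaseSystem d n) (c : Fin d → Fin n) : Prop :=
  Finset.univ.image c ∈ B.carrier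

/-- A reference basis of `B`, listed in increasing order. -/
def BaseSystem.refBasis {d n : ℕ} (B : BaseSystem d n) : Fin d → Fin n :=
  B.nonempty.some.orderEmbOfFin (B.card_eq _ B.nonempty.some_mem)

theorem BaseSystem.refBasis_mem {d n : ℕ} (B : BaseSystem d n) : B.Mem B.refBasis := by
  unfold BaseSystem.Mem BaseSystem.refBasis
  rw [Finset.image_orderEmbOfFin_univ]
  exact B.nonempty.some_mem

theorem BaseSystem.Mem.injective {d n : ℕ} {B : BaseSystem d n} {c : Fin d → Fin n}
    (h : B.Mem c) : Function.Injective c := by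
  have h1 := B.card_eq _ h
  have h2 : (Finset.univ.image c).card = (Finset.univ : Finset (Fin d)).card := by simpa using h1
  have h3 := Finset.card_image_iff.mp h2
  simpa [Set.injOn_univ] using h3

/-- The convex hull of the indicator vectors `e_l`, `l ∈ B'`, is a (nonempty) face of the convex
hull of the indicator vectors `e_l`, `l ∈ B`: some linear functional `u` attains its minimum over
the second set of vectors exactly on the first one. -/
def IsFace {d n : ℕ} (B' B : BaseSystem d n) : Prop :=
  ∃ u : Fin n → ℝ, ∀ l, l ∈ B'.carrier ↔
    l ∈ B.carrier ∧ ∀ m ∈ B.carrier, ∑ i ∈ l, u i ≤ ∑ i ∈ m, u i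

/-! ### Strata: matrix coordinates -/

/-- The maximal minor of `A` on the columns `c 0, c 1, …`, in this order. -/
def minor {d n : ℕ} {R : Type*} [CommRing R] (A : Matrix (Fin d) (Fin n) R)
    (c : Fin d → Fin n) : R :=
  (A.submatrix id c).det

/-- The variables `x_{ij}`: `i` is a row, `j` is a column outside the reference basis `b`, and
exchanging the `i`-th element of `b` for `j` gives a member of `B`. -/
abbrev Var {d n : ℕ} (B : BaseSystem d n) (b : Fin d → Fin n) : Type :=
  {p : Fin d × Fin n // p.2 ∉ Set.range b ∧ B.Mem (Function.update b p.1 p.2)}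

open Classical in
/-- The `d × n` matrix which is the identity in the columns of the reference basis `b`, and whose
entry `(i, j)` for `j` outside `b` is the variable `x_{ij}`, or `0` if there is no such variable. -/
def coordMatrix {d n : ℕ} (B : BaseSystem d n) (b : Fin d → Fin n) :
    Matrix (Fin d) (Fin n) (MvPolynomial (Var B b) ℂ) :=
  Matrix.of fun i j =>
    if b i = j then 1
    else if h : j ∉ Set.range b ∧ B.Mem (Function.update b i j) then MvPolynomial.X ⟨(i, j), h⟩
    else 0

/-- The ideal generated by the minors that are indexed by non-members of `B`. (All orderings of the
columns are allowed; this changes the generators by signs only, and adds the generator `0`.) -/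
def coordIdeal {d n : ℕ} (B : BaseSystem d n) (b : Fin d → Fin n) :
    Ideal (MvPolynomial (Var B b) ℂ) :=
  Ideal.span {f | ∃ c, ¬ B.Mem c ∧ f = minor (coordMatrix B b) c}

/-- The multiplicative monoid generated by the minors that are indexed by members of `B`. (All
orderings of the columns are allowed; this changes the generators by signs only.) -/
def coordMonoid {d n : ℕ} (B : BaseSystem d n) (b : Fin d → Fin n) :
    Submonoid (MvPolynomial (Var B b) ℂ) :=
  Submonoid.closure {f | ∃ c, B.Mem c ∧ f = minor (coordMatrix B b) c}

/-- The coordinate ring of the stratum of `B` in the matrix coordinates given by the reference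
basis `b`: the polynomial ring modulo `coordIdeal`, localized at `coordMonoid`. -/
abbrev CoordRing {d n : ℕ} (B : BaseSystem d n) (b : Fin d → Fin n) : Type :=
  Localization ((coordMonoid B b).map (Ideal.Quotient.mk (coordIdeal B b)))

/-- The canonical map from the polynomial ring to the coordinate ring. -/
def toCoordRing {d n : ℕ} (B : BaseSystem d n) (b : Fin d → Fin n) :
    MvPolynomial (Var B b) ℂ →+* CoordRing B b :=
  (algebraMap _ (CoordRing B b)).comp (Ideal.Quotient.mk (coordIdeal B b))

/-- The Plücker coordinate with index `c`, as a function on the stratum: the `c`-th maximal minor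
of the coordinate matrix. -/
def plucker {d n : ℕ} (B : BaseSystem d n) (b : Fin d → Fin n) (c : Fin d → Fin n) :
    CoordRing B b :=
  toCoordRing B b (minor (coordMatrix B b) c)

/-- The scheme `Gr(B; ℂ)`; if `B` is the set of bases of a matroid `Q`, this is the matroid stratum
`Gr(Q; ℂ)`. -/
def Gr {d n : ℕ} (B : BaseSystem d n) : Scheme.{0} :=
  Spec (CommRingCat.of (CoordRing B B.refBasis))

/-! ### Face morphisms -/

theorem map_minor {d n : ℕ} {R S : Type*} [CommRing R] [CommRing S] (f : R →+* S)
    (A : Matrix (Fin d) (Fin n) R) (c : Fin d → Fin n) :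
    f (minor A c) = minor (A.map f) c := by
  unfold minor
  rw [RingHom.map_det]
  rfl

theorem minor_update_eq_cramer {d n : ℕ} {R : Type*} [CommRing R] (A : Matrix (Fin d) (Fin n) R)
    (b : Fin d → Fin n) (i : Fin d) (j : Fin n) :
    minor A (Function.update b i j) = Matrix.cramer (A.submatrix id b) (fun k => A k j) i := by
  rw [Matrix.cramer_apply, minor]
  congr 1
  ext k l
  by_cases h : l = i
  · subst h; simp
  · simp [h]

/-- Cramer's rule: the entries of `A_b⁻¹ A`. -/
theorem det_ratio {d n : ℕ} {R : Type*} [CommRing R] (A : Matrix (Fin d) (Fin n) R)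
    (b : Fin d → Fin n) (c : Fin d → Fin n) :
    (Matrix.of fun i k => minor A (Function.update b i (c k)) * Ring.inverse (minor A b)).det =
      minor A c * Ring.inverse (minor A b) := by
  have h1 : (Matrix.of fun i k => minor A (Function.update b i (c k)) * Ring.inverse (minor A b)) =
      (A.submatrix id b)⁻¹ * A.submatrix id c := by
    ext i k
    rw [Matrix.inv_def, Matrix.smul_mul, Matrix.smul_apply, Matrix.of_apply,
      minor_update_eq_cramer, Matrix.cramer_eq_adjugate_mulVec, smul_eq_mul, mul_comm]
    rfl
  rw [h1, Matrix.det_mul, Matrix.det_nonsing_inv, mul_comm]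
  rfl

theorem sum_image {d n : ℕ} (u : Fin n → ℝ) {c : Fin d → Fin n} (hc : Function.Injective c) :
    ∑ i ∈ Finset.univ.image c, u i = ∑ k, u (c k) :=
  Finset.sum_image (fun _ _ _ _ h => hc h)

theorem sum_update {d n : ℕ} (u : Fin n → ℝ) (b : Fin d → Fin n) (i : Fin d) (j : Fin n) :
    ∑ k, u (Function.update b i j k) = ∑ k, u (b k) - u (b i) + u j := by
  rw [← Finset.add_sum_erase _ _ (Finset.mem_univ i),
    ← Finset.add_sum_erase (a := i) Finset.univ (fun k => u (b k)) (Finset.mem_univ i)]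
  have : ∑ x ∈ Finset.univ.erase i, u (Function.update b i j x) =
      ∑ x ∈ Finset.univ.erase i, u (b x) :=
    Finset.sum_congr rfl fun x hx => by rw [Function.update_of_ne (Finset.ne_of_mem_erase hx)]
  rw [this, Function.update_self]
  ring

open Classical in
/-- If `B'` is a face of `B` and the minors of `A` that are indexed by non-members of `B` vanish,
then deleting from `A_b⁻¹ A` the entries that do not belong to `B'` keeps the minors with index in
`B'`, and makes all other ones zero. -/
theorem det_face {d n : ℕ} {R : Type*} [CommRing R] {B' B : BaseSystem d n} (hf : IsFace B' B)
    (A : Matrix (Fin d) (Fin n) R) (hA : ∀ c, ¬ B.Mem c → minor A c = 0)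
    (b : Fin d → Fin n) (hb : B'.Mem b) (c : Fin d → Fin n) :
    (Matrix.of fun i k => if B'.Mem (Function.update b i (c k)) then
      minor A (Function.update b i (c k)) * Ring.inverse (minor A b) else 0).det =
      if B'.Mem c then minor A c * Ring.inverse (minor A b) else 0 := by
  obtain ⟨u, hface⟩ := hf
  have hmem : ∀ c : Fin d → Fin n, B'.Mem c ↔ B.Mem c ∧ ∑ k, u (c k) = ∑ k, u (b k) := by
    intro c
    have hbB := (hface _).1 hb
    constructor
    · intro h
      have h' := (hface _).1 h
      refine ⟨h'.1, ?_⟩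
      rw [← sum_image u h.injective, ← sum_image u hb.injective]
      exact le_antisymm (h'.2 _ hbB.1) (hbB.2 _ h'.1)
    · rintro ⟨h1, h2⟩
      refine (hface _).2 ⟨h1, fun m hm => ?_⟩
      rw [sum_image u h1.injective, h2, ← sum_image u hb.injective]
      exact hbB.2 m hm
  have hge : ∀ c : Fin d → Fin n, B.Mem c → ∑ k, u (b k) ≤ ∑ k, u (c k) := by
    intro c h
    have := ((hface _).1 hb).2 _ h
    rwa [sum_image u h.injective, sum_image u hb.injective] at this
  have hsum : ∀ s : Equiv.Perm (Fin d),
      ∑ k, (u (c k) - u (b (s k))) = ∑ k, u (c k) - ∑ k, u (b k) := by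
    intro s
    rw [Finset.sum_sub_distrib, Equiv.sum_comp s (fun k => u (b k))]
  by_cases hw : ∑ k, u (c k) = ∑ k, u (b k)
  · have key : (Matrix.of fun i k => if B'.Mem (Function.update b i (c k)) then
      minor A (Function.update b i (c k)) * Ring.inverse (minor A b) else 0).det =
      minor A c * Ring.inverse (minor A b) := by
      rw [← det_ratio A b c, Matrix.det_apply, Matrix.det_apply]
      refine Finset.sum_congr rfl fun s _ => ?_
      congr 1
      simp only [Matrix.of_apply]
      by_cases hall : ∀ k, B'.Mem (Function.update b (s k) (c k))
      · exact Finset.prod_congr rfl fun k _ => by rw [if_pos (hall k)]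
      · push Not at hall
        obtain ⟨k0, hk0⟩ := hall
        rw [Finset.prod_eq_zero (Finset.mem_univ k0) (by rw [if_neg hk0])]
        have : ∃ k, ¬ B.Mem (Function.update b (s k) (c k)) := by
          by_contra! hB
          have hnn : ∀ k, 0 ≤ u (c k) - u (b (s k)) := by
            intro k
            have := hge _ (hB k)
            rw [sum_update] at this
            linarith
          have h0 : ∑ k, (u (c k) - u (b (s k))) = 0 := by rw [hsum, hw, sub_self]
          have h1 := (Finset.sum_eq_zero_iff_of_nonneg (fun k _ => hnn k)).1 h0 k0
            (Finset.mem_univ _)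
          refine hk0 ((hmem _).2 ⟨hB k0, ?_⟩)
          rw [sum_update]
          linarith
        obtain ⟨k, hk⟩ := this
        rw [Finset.prod_eq_zero (Finset.mem_univ k) (by rw [hA _ hk, zero_mul])]
    rw [key]
    split_ifs with hc
    · rfl
    · have : ¬ B.Mem c := fun h => hc ((hmem c).2 ⟨h, hw⟩)
      rw [hA c this, zero_mul]
  · rw [if_neg fun h => hw ((hmem c).1 h).2, Matrix.det_apply]
    refine Finset.sum_eq_zero fun s _ => ?_
    simp only [Matrix.of_apply]
    have : ∃ k, ¬ B'.Mem (Function.update b (s k) (c k)) := by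
      by_contra! hB
      apply hw
      have h0 : ∑ k, (u (c k) - u (b (s k))) = 0 := by
        refine Finset.sum_eq_zero fun k _ => ?_
        have := ((hmem _).1 (hB k)).2
        rw [sum_update] at this
        linarith
      rw [hsum] at h0
      linarith
    obtain ⟨k, hk⟩ := this
    rw [Finset.prod_eq_zero (Finset.mem_univ k) (by rw [if_neg hk]), smul_zero]

theorem plucker_eq_zero {d n : ℕ} (B : BaseSystem d n) (b c : Fin d → Fin n) (h : ¬ B.Mem c) :
    plucker B b c = 0 := by
  have : Ideal.Quotient.mk (coordIdeal B b) (minor (coordMatrix B b) c) = 0 :=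
    Ideal.Quotient.eq_zero_iff_mem.2 (Ideal.subset_span ⟨c, h, rfl⟩)
  rw [plucker, toCoordRing, RingHom.comp_apply, this, map_zero]

theorem isUnit_plucker {d n : ℕ} (B : BaseSystem d n) (b c : Fin d → Fin n) (h : B.Mem c) :
    IsUnit (plucker B b c) :=
  IsLocalization.map_units (CoordRing B b)
    (⟨_, Submonoid.mem_map_of_mem _ (Submonoid.subset_closure ⟨c, h, rfl⟩)⟩ :
      (coordMonoid B b).map (Ideal.Quotient.mk (coordIdeal B b)))

theorem plucker_self {d n : ℕ} (B : BaseSystem d n) (b : Fin d → Fin n)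
    (hb : Function.Injective b) : plucker B b b = 1 := by
  have : (coordMatrix B b).submatrix id b = 1 := by
    ext i j
    by_cases h : i = j
    · subst h; simp [coordMatrix]
    · simp [coordMatrix, h, hb.eq_iff]
  rw [plucker, minor, this, Matrix.det_one, map_one]

theorem plucker_update {d n : ℕ} (B : BaseSystem d n) (b : Fin d → Fin n)
    (hb : Function.Injective b) (p : Var B b) :
    plucker B b (Function.update b p.1.1 p.1.2) = toCoordRing B b (MvPolynomial.X p) := by
  have h1 : (coordMatrix B b).submatrix id b = 1 := by
    ext i j
    by_cases h : i = j
    · subst h; simp [coordMatrix]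
    · simp [coordMatrix, h, hb.eq_iff]
  rw [plucker, minor_update_eq_cramer, h1, Matrix.cramer_one]
  congr 1
  have h2 : b p.1.1 ≠ p.1.2 := fun h => p.2.1 ⟨_, h⟩
  simp [coordMatrix, h2, p.2]

/-- On polynomial rings, the face homomorphism sends the variable `x_{ij}`, which is the Plücker
coordinate of the exchanged basis divided by that of the reference basis `b'`, to the same
quotient of Plücker coordinates. -/
def facePoly {d n : ℕ} (B' B : BaseSystem d n) (b' b : Fin d → Fin n) :
    MvPolynomial (Var B' b') ℂ →+* CoordRing B b :=
  MvPolynomial.eval₂Hom ((toCoordRing B b).comp MvPolynomial.C) fun p =>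
    plucker B b (Function.update b' p.1.1 p.1.2) * Ring.inverse (plucker B b b')

open Classical in
theorem facePoly_minor {d n : ℕ} {B' B : BaseSystem d n} (hf : IsFace B' B)
    (b' b : Fin d → Fin n) (hb' : B'.Mem b') (c : Fin d → Fin n) :
    facePoly B' B b' b (minor (coordMatrix B' b') c) =
      if B'.Mem c then plucker B b c * Ring.inverse (plucker B b b') else 0 := by
  have hsub : B.Mem b' := by
    obtain ⟨u, hu⟩ := hf
    exact ((hu _).1 hb').1
  have hpl : ∀ c, plucker B b c = minor ((coordMatrix B b).map (toCoordRing B b)) c := fun c =>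
    map_minor _ _ _
  have hunit := isUnit_plucker B b b' hsub
  have hz := fun c hc => plucker_eq_zero B b c hc
  simp only [hpl] at hunit hz
  rw [hpl, hpl, ← det_face hf _ hz b' hb' c, map_minor, minor]
  congr 1
  ext i k
  rw [Matrix.submatrix_apply, Matrix.map_apply, Matrix.of_apply, coordMatrix, Matrix.of_apply]
  simp only [id]
  by_cases h : b' i = c k
  · rw [if_pos h, ← h, Function.update_eq_self, if_pos hb', map_one,
      Ring.mul_inverse_cancel _ hunit]
  · rw [if_neg h]
    by_cases hr : c k ∈ Set.range b'
    · obtain ⟨l, hl⟩ := hr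
      have hnot : ¬ B'.Mem (Function.update b' i (c k)) := by
        intro hm
        have hli : l ≠ i := fun e => h (e ▸ hl)
        have := @BaseSystem.Mem.injective d n B' _ hm l i (by
          rw [Function.update_of_ne hli, Function.update_self, hl])
        exact hli this
      rw [dif_neg (fun e => hnot e.2), if_neg hnot, map_zero]
    · by_cases hm : B'.Mem (Function.update b' i (c k))
      · rw [dif_pos ⟨hr, hm⟩, if_pos hm]
        rw [facePoly, MvPolynomial.coe_eval₂Hom, MvPolynomial.eval₂_X, hpl, hpl]
      · rw [dif_neg (fun e => hm e.2), if_neg hm, map_zero]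

/-- The homomorphism of coordinate rings belonging to a face `B'` of `B`. It preserves the quotients
of Plücker coordinates with indices in `B'`, that is, it is induced by the inclusion of polynomial
rings `ℂ[p_l : l ∈ B'] ⊆ ℂ[p_l : l ∈ B]`, see `faceHom_plucker`. -/
def faceHom {d n : ℕ} {B' B : BaseSystem d n} (hf : IsFace B' B) (b' b : Fin d → Fin n)
    (hb' : B'.Mem b') : CoordRing B' b' →+* CoordRing B b :=
  IsLocalization.lift (M := (coordMonoid B' b').map (Ideal.Quotient.mk (coordIdeal B' b')))
    (g := Ideal.Quotient.lift (coordIdeal B' b') (facePoly B' B b' b) (by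
      have : coordIdeal B' b' ≤ RingHom.ker (facePoly B' B b' b) := by
        refine Ideal.span_le.2 ?_
        rintro _ ⟨c, hc, rfl⟩
        simp only [SetLike.mem_coe, RingHom.mem_ker]
        rw [facePoly_minor hf b' b hb', if_neg hc]
      exact fun a ha => RingHom.mem_ker.1 (this ha))) (by
      rintro ⟨_, y, hy, rfl⟩
      have : coordMonoid B' b' ≤
          (IsUnit.submonoid (CoordRing B b)).comap (facePoly B' B b' b).toMonoidHom := by
        refine Submonoid.closure_le.2 ?_
        rintro _ ⟨c, hc, rfl⟩
        change IsUnit (facePoly B' B b' b (minor (coordMatrix B' b') c))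
        have hsub : ∀ c, B'.Mem c → B.Mem c := by
          obtain ⟨u, hu⟩ := hf
          exact fun c hc => ((hu _).1 hc).1
        rw [facePoly_minor hf b' b hb', if_pos hc]
        exact (isUnit_plucker B b c (hsub c hc)).mul
          (isUnit_plucker B b b' (hsub b' hb')).ringInverse
      exact this hy)

theorem faceHom_toCoordRing {d n : ℕ} {B' B : BaseSystem d n} (hf : IsFace B' B)
    (b' b : Fin d → Fin n) (hb' : B'.Mem b') (f : MvPolynomial (Var B' b') ℂ) :
    faceHom hf b' b hb' (toCoordRing B' b' f) = facePoly B' B b' b f := by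
  rw [faceHom, toCoordRing, RingHom.comp_apply, IsLocalization.lift_eq, Ideal.Quotient.lift_mk]

theorem faceHom_plucker {d n : ℕ} {B' B : BaseSystem d n} (hf : IsFace B' B)
    (b' b : Fin d → Fin n) (hb' : B'.Mem b') (c : Fin d → Fin n) (hc : B'.Mem c) :
    faceHom hf b' b hb' (plucker B' b' c) = plucker B b c * Ring.inverse (plucker B b b') := by
  rw [plucker, faceHom_toCoordRing, facePoly_minor hf b' b hb', if_pos hc]

theorem coordRing_hom_ext {d n : ℕ} {B : BaseSystem d n} {b : Fin d → Fin n} {R : Type*}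
    [CommRing R] {f g : CoordRing B b →+* R}
    (hC : ∀ z, f (toCoordRing B b (MvPolynomial.C z)) = g (toCoordRing B b (MvPolynomial.C z)))
    (hX : ∀ p, f (toCoordRing B b (MvPolynomial.X p)) = g (toCoordRing B b (MvPolynomial.X p))) :
    f = g := by
  refine IsLocalization.ringHom_ext
    ((coordMonoid B b).map (Ideal.Quotient.mk (coordIdeal B b))) ?_
  refine Ideal.Quotient.ringHom_ext ?_
  exact MvPolynomial.ringHom_ext hC hX

theorem faceHom_C {d n : ℕ} {B' B : BaseSystem d n} (hf : IsFace B' B)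
    (b' b : Fin d → Fin n) (hb' : B'.Mem b') (z : ℂ) :
    faceHom hf b' b hb' (toCoordRing B' b' (MvPolynomial.C z)) =
      toCoordRing B b (MvPolynomial.C z) := by
  rw [faceHom_toCoordRing, facePoly, MvPolynomial.coe_eval₂Hom, MvPolynomial.eval₂_C,
    RingHom.comp_apply]

theorem faceHom_id {d n : ℕ} {B : BaseSystem d n} (hf : IsFace B B)
    (b : Fin d → Fin n) (hb : B.Mem b) : faceHom hf b b hb = RingHom.id _ := by
  refine coordRing_hom_ext (fun z => faceHom_C hf b b hb z) fun p => ?_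
  rw [← plucker_update B b hb.injective p, faceHom_plucker hf b b hb _ p.2.2,
    plucker_self B b hb.injective, Ring.inverse_one, mul_one, RingHom.id_apply]

theorem faceHom_comp {d n : ℕ} {B'' B' B : BaseSystem d n} (hf : IsFace B'' B')
    (hg : IsFace B' B) (hh : IsFace B'' B) (b'' b' b : Fin d → Fin n) (hb'' : B''.Mem b'')
    (hb' : B'.Mem b') :
    (faceHom hg b' b hb').comp (faceHom hf b'' b' hb'') = faceHom hh b'' b hb'' := by
  have hsub : ∀ c, B''.Mem c → B'.Mem c := by
    obtain ⟨u, hu⟩ := hf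
    exact fun c hc => ((hu _).1 hc).1
  have hsub' : ∀ c, B'.Mem c → B.Mem c := by
    obtain ⟨u, hu⟩ := hg
    exact fun c hc => ((hu _).1 hc).1
  refine coordRing_hom_ext (fun z => ?_) fun p => ?_
  · rw [RingHom.comp_apply, faceHom_C, faceHom_C, faceHom_C]
  · rw [← plucker_update B'' b'' hb''.injective p, RingHom.comp_apply,
      faceHom_plucker hf b'' b' hb'' _ p.2.2, faceHom_plucker hh b'' b hb'' _ p.2.2, map_mul,
      faceHom_plucker hg b' b hb' _ (hsub _ p.2.2)]
    have h1 := isUnit_plucker B' b' b'' (hsub _ hb'')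
    have h2 := isUnit_plucker B b b'' (hsub' _ (hsub _ hb''))
    have h3 := isUnit_plucker B b b' (hsub' _ hb')
    have h4 : faceHom hg b' b hb' (Ring.inverse (plucker B' b' b'')) *
        (plucker B b b'' * Ring.inverse (plucker B b b')) = 1 := by
      rw [← faceHom_plucker hg b' b hb' _ (hsub _ hb''), ← map_mul,
        Ring.inverse_mul_cancel _ h1, map_one]
    calc _ = plucker B b (Function.update b'' p.1.1 p.1.2) *
          (faceHom hg b' b hb' (Ring.inverse (plucker B' b' b'')) *
            (plucker B b b'' * Ring.inverse (plucker B b b'))) *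
            Ring.inverse (plucker B b b'') := by
          rw [mul_assoc, mul_assoc, mul_assoc]
          congr 1
          have h5 := Ring.mul_inverse_cancel _ h2
          linear_combination (-(Ring.inverse (plucker B b b') *
            faceHom hg b' b hb' (Ring.inverse (plucker B' b' b'')))) * h5
      _ = _ := by rw [h4, mul_one]

/-- The face morphism `Gr(B) ⟶ Gr(B')` for a face `B'` of `B`. -/
def faceMorphism {d n : ℕ} {B' B : BaseSystem d n} (hf : IsFace B' B) : Gr B ⟶ Gr B' :=
  Spec.map (CommRingCat.ofHom (faceHom hf B'.refBasis B.refBasis B'.refBasis_mem))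

/-! ### Regular subdivisions of the hypersimplex and inverse limits of strata -/

/-- The `d`-subsets `l` of `Fin n` that minimize `⟨e_l, v⟩ + w_l`. -/
def minimizers (d : ℕ) {n : ℕ} (w : Finset (Fin n) → ℝ) (v : Fin n → ℝ) : Set (Finset (Fin n)) :=
  {l | l.card = d ∧ ∀ m : Finset (Fin n), m.card = d →
    ∑ i ∈ l, v i + w l ≤ ∑ i ∈ m, v i + w m}

/-- The cells of the regular subdivision of the hypersimplex `Δ(d,n)` induced by the heights `w`
(only the values on `d`-subsets matter), each given by its set of vertices. The order is inclusion,
which is the face relation, see `cell_le_iff_isFace`. -/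
abbrev Cell {d n : ℕ} (w : Finset (Fin n) → ℝ) : Type :=
  {B : BaseSystem d n // ∃ v, B.carrier = minimizers d w v}

theorem cell_le_iff_isFace {d n : ℕ} {w : Finset (Fin n) → ℝ} (B' B : Cell (d := d) w) :
    B' ≤ B ↔ IsFace B'.1 B.1 := by
  constructor
  · intro h
    have hsub : B'.1.carrier ⊆ B.1.carrier := h
    obtain ⟨v', hv'⟩ := B'.2
    obtain ⟨v, hv⟩ := B.2
    obtain ⟨l0, hl0⟩ := B'.1.nonempty
    refine ⟨fun i => v' i - v i, fun l => ?_⟩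
    have e : ∀ l m, l ∈ B.1.carrier → m ∈ B.1.carrier →
        ∑ i ∈ l, v i + w l ≤ ∑ i ∈ m, v i + w m := by
      intro l m hl hm
      rw [hv] at hl hm
      exact hl.2 m hm.1
    simp only [Finset.sum_sub_distrib]
    constructor
    · intro hl
      refine ⟨hsub hl, fun m hm => ?_⟩
      have h1 := e m l hm (hsub hl)
      rw [hv'] at hl
      have h2 := hl.2 m (B.1.card_eq m hm)
      linarith
    · rintro ⟨hl, hmin⟩
      have h1 := hmin l0 (hsub hl0)
      have h2 := e l l0 hl (hsub hl0)
      rw [hv'] at hl0 ⊢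
      refine ⟨B.1.card_eq l hl, fun m hm => ?_⟩
      have h3 := hl0.2 m hm
      linarith
  · rintro ⟨u, hu⟩ l hl
    exact ((hu l).1 hl).1

/-- The coordinate rings of the strata of the cells, with the face homomorphisms. -/
def cellRings {d n : ℕ} (w : Finset (Fin n) → ℝ) : Cell (d := d) w ⥤ CommRingCat.{0} where
  obj B := CommRingCat.of (CoordRing B.1 B.1.refBasis)
  map {B' B} h := CommRingCat.ofHom (faceHom ((cell_le_iff_isFace B' B).1 (leOfHom h))
    B'.1.refBasis B.1.refBasis B'.1.refBasis_mem)
  map_id B := by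
    rw [faceHom_id]
    rfl
  map_comp {B'' B' B} f g := by
    rw [← CommRingCat.ofHom_comp, faceHom_comp]

/-- The diagram of the strata `Gr(B)` of the cells `B` and the face morphisms `Gr(B) ⟶ Gr(B')`,
contravariant in the poset of cells. -/
def strataDiagram {d n : ℕ} (w : Finset (Fin n) → ℝ) : (Cell (d := d) w)ᵒᵖ ⥤ Scheme.{0} :=
  (cellRings w).op ⋙ Scheme.Spec

theorem strataDiagram_obj {d n : ℕ} (w : Finset (Fin n) → ℝ) (B : Cell (d := d) w) :
    (strataDiagram w).obj (Opposite.op B) = Gr B.1 :=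
  rfl

theorem strataDiagram_map {d n : ℕ} (w : Finset (Fin n) → ℝ) {B' B : Cell (d := d) w}
    (h : B' ⟶ B) : (strataDiagram w).map h.op =
      faceMorphism ((cell_le_iff_isFace B' B).1 (leOfHom h)) :=
  rfl

instance {d n : ℕ} (w : Finset (Fin n) → ℝ) : HasLimit (strataDiagram (d := d) w) := by
  have : Fintype (Cell (d := d) w) := Fintype.ofFinite _
  infer_instance

/-- The inverse limit `Gr(w)` of the strata of the cells of the subdivision induced by `w`. -/
def GrLimit (d : ℕ) {n : ℕ} (w : Finset (Fin n) → ℝ) : Scheme.{0} :=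
  limit (strataDiagram (d := d) w)

/-- The structural morphism from the inverse limit to the stratum of the cell `B`. -/
def GrLimit.proj {d n : ℕ} (w : Finset (Fin n) → ℝ) (B : Cell (d := d) w) :
    GrLimit d w ⟶ Gr B.1 :=
  limit.π (strataDiagram w) (Opposite.op B)

/-! ### Matroids -/

/-- The bases of a matroid of rank `d` on `Fin n`. -/
def bases {d n : ℕ} (Q : Matroid (Fin n)) (hd : Q.eRank = d) : BaseSystem d n where
  carrier := {l | Q.IsBase l}
  card_eq l hl := by
    have h : (l : Set (Fin n)).encard = Q.eRank := Matroid.IsBase.encard_eq_eRank hl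
    rw [hd, Set.encard_coe_eq_coe_finsetCard] at h
    exact_mod_cast h
  nonempty := by
    obtain ⟨B, hB⟩ := Q.exists_isBase
    classical
    exact ⟨B.toFinset, by simpa using hB⟩

/-- The corank vector of a matroid `Q` of rank `d`: `w_l = d - rank of l`. -/
def corank (d : ℕ) {n : ℕ} (Q : Matroid (Fin n)) (l : Finset (Fin n)) : ℝ :=
  (d : ℝ) - ((Q.eRk l).toNat : ℝ)

/-- The bases of `Q` are a cell of the subdivision induced by the corank vector of `Q`. -/
def centralCell {d n : ℕ} (Q : Matroid (Fin n)) (hd : Q.eRank = d) :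
    Cell (d := d) (corank d Q) :=
  ⟨bases Q hd, 0, by
    have hle : ∀ l : Finset (Fin n), (Q.eRk l).toNat ≤ d := by
      intro l
      have h := Q.eRk_le_eRank l
      rw [hd] at h
      exact ENat.toNat_le_of_le_natCast h
    have hbase : ∀ l : Finset (Fin n), Q.IsBase l → (Q.eRk l).toNat = d := by
      intro l hl
      rw [hl.eRk_eq_eRank, hd, ENat.toNat_natCast]
    ext l
    simp only [bases, minimizers, Set.mem_ofPred_eq, Pi.zero_apply, Finset.sum_const_zero, zero_add,
      corank]
    constructor
    · intro hl
      refine ⟨(bases Q hd).card_eq l hl, fun m _ => ?_⟩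
      have h1 := hbase l hl
      have h2 := hle m
      have h3 : ((Q.eRk m).toNat : ℝ) ≤ d := by exact_mod_cast h2
      rw [h1]
      linarith
    · rintro ⟨hl, hmin⟩
      obtain ⟨m, hm⟩ := (bases Q hd).nonempty
      have h1 := hmin m ((bases Q hd).card_eq m hm)
      rw [hbase m hm] at h1
      have h2 : (d : ℝ) ≤ ((Q.eRk l).toNat : ℝ) := by linarith
      have h3 : d ≤ (Q.eRk l).toNat := by exact_mod_cast h2
      have h4 : (d : ℕ∞) ≤ Q.eRk l :=
        le_trans (by exact_mod_cast h3) (ENat.natCast_toNat_le_self _)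
      have hcard : (l : Set (Fin n)).encard = d := by
        rw [Set.encard_coe_eq_coe_finsetCard, hl]
      have hind : Q.Indep (l : Set (Fin n)) := by
        rw [Matroid.indep_iff_eRk_eq_encard_of_finite l.finite_toSet]
        exact le_antisymm (Q.eRk_le_encard _) (hcard ▸ h4)
      exact hind.isBase_of_eRk_ge l.finite_toSet (hd ▸ h4)⟩

/-- `Q` is paving of rank `d`: every circuit has at least `d` elements. -/
def IsPaving {n : ℕ} (d : ℕ) (Q : Matroid (Fin n)) : Prop :=
  ∀ C, Q.IsCircuit C → (d : ℕ∞) ≤ C.encard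

/-- `Q` is connected: it is not the direct sum of two matroids on nonempty ground sets. -/
def IsConnected {n : ℕ} (Q : Matroid (Fin n)) : Prop :=
  ¬ ∃ (Q₁ Q₂ : Matroid (Fin n)) (h : Disjoint Q₁.E Q₂.E),
    Q₁.E.Nonempty ∧ Q₂.E.Nonempty ∧ Q = Q₁.disjointSum Q₂ h

/-- `η` is a cyclic hyperplane of the matroid `Q` of rank `d`: a flat of rank `d - 1` such that the
restriction of `Q` to it has no coloops. -/
def IsCyclicHyperplane {n : ℕ} (d : ℕ) (Q : Matroid (Fin n)) (η : Finset (Fin n)) : Prop :=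
  Q.IsFlat (η : Set (Fin n)) ∧ Q.eRk (η : Set (Fin n)) + 1 = d ∧
    ∀ e, ¬ (Q.restrict (η : Set (Fin n))).IsColoop e

open Classical in
/-- The set of cyclic hyperplanes. Each of them has at least `d - 1` elements, so that
`η.card + 1 - d` is never a truncated difference. -/
def cyclicHyperplanes {n : ℕ} (d : ℕ) (Q : Matroid (Fin n)) : Finset (Finset (Fin n)) :=
  Finset.univ.filter (IsCyclicHyperplane d Q)

end MatroidStrata

end

/-! For a paving matroid the corank of a `d`-set is 0 on bases and 1 on non-bases. Any `d - 1`
elements are independent, so they span every cyclic hyperplane that contains them. Consequently each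
non-basis lies in exactly one cyclic hyperplane `η`, namely its closure.

The subdivision is therefore a star. Apart from the faces of the central cell, every cell lies in
exactly one cell "beyond" some `η`, whose vertices are the `d`-sets with at least `d - 1` elements
on `η`. That cell meets the central one in the wall of sets with exactly `d - 1` elements on `η`
(`isStar_cells`). A compatible family over all cells is thus a point of the stratum of `Q` together
with, for each `η`, a lift of its image in the stratum of the wall to the stratum beyond.

The lifts are visible in matrices. Normalize at a basis `β` of the wall with `β k` its only element
off `η`. In a matrix of the wall the columns off `η` are supported in row `k`, and the columns on
`η` vanish there. A matrix of the cell beyond is obtained by filling row `k` freely in the columns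
of `η` outside `β`, which are `|η| - d + 1` in number. This changes no minor of the wall, and the
only condition is that the minors with all columns on `η` be invertible
(`Adapted.represents_extMatrix`, `Adapted.extMatrix_eq`). Such a minor is a linear form in the new
entries, and those of its coefficients that belong to columns outside `β` are, up to sign, minors of
the wall, hence units. At least one such column occurs, so the form vanishes identically on no fiber
(`minor_beyondMatrix_notMem`).

Hence the structural morphism is the projection to the stratum of `Q` of a principal open subset of
an affine space over it, and this open subset meets every fiber (`exists_iso_proj`,
`newMinors_notMem`). Smoothness, surjectivity, connected (even irreducible) fibers and the dimension
formula follow from general facts about such open subsets. -/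

noncomputable section

namespace MatroidStrata

/-! ### Principal open subsets of affine spaces over a Noetherian base -/

/-- Every prime of `A` is the start of a prime of `B` of height larger by at least `n`, and the
latter can be chosen to avoid any given element of `B` that does not vanish on the fiber. -/
def RaisesHeight (A B : Type*) [CommRing A] [CommRing B] [Algebra A B] (n : ℕ) : Prop :=
  ∀ (p : Ideal A) (f : B), p.IsPrime → f ∉ p.map (algebraMap A B) →
    ∃ P : Ideal B, P.IsPrime ∧ f ∉ P ∧ p.height + n ≤ P.height

theorem RaisesHeight.of_algEquiv {A B B' : Type*} [CommRing A] [CommRing B] [CommRing B']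
    [Algebra A B] [Algebra A B'] {n : ℕ} (h : RaisesHeight A B n) (e : B' ≃ₐ[A] B) :
    RaisesHeight A B' n := by
  intro p f hp hf
  have hf' : e f ∉ p.map (algebraMap A B) := by
    intro hmem
    apply hf
    have h1 := Ideal.mem_map_of_mem (e.symm : B →+* B') hmem
    have h2 : (e.symm : B →+* B').comp (algebraMap A B) = algebraMap A B' := by
      ext a; simp
    rw [Ideal.map_map, h2] at h1
    simpa using h1
  obtain ⟨P, hP, hfP, hh⟩ := h p (e f) hp hf'
  refine ⟨P.comap (e : B' ≃+* B), Ideal.comap_isPrime _ _, hfP, ?_⟩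
  rwa [RingEquiv.height_comap]

theorem RaisesHeight.self (A : Type*) [CommRing A] : RaisesHeight A A 0 := by
  intro p f hp hf
  rw [Algebra.algebraMap_self, Ideal.map_id] at hf
  exact ⟨p, hp, hf, by simp⟩

/-- The quotient `B ⧸ P` is an infinite domain because it contains `K`, and over such a domain a
nonzero polynomial has a nonzero value. -/
theorem exists_eval_notMem (K : Type*) {B : Type*} [Field K] [Infinite K] [CommRing B]
    [Algebra K B] (P : Ideal B) [P.IsPrime] (f : Polynomial B)
    (hf : f ∉ P.map (Polynomial.C : B →+* Polynomial B)) : ∃ a : B, f.eval a ∉ P := by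
  have : Infinite (B ⧸ P) :=
    Infinite.of_injective (algebraMap K (B ⧸ P)) (algebraMap K (B ⧸ P)).injective
  have hne : f.map (Ideal.Quotient.mk P) ≠ 0 := by
    intro h0
    apply hf
    rw [Ideal.mem_map_C_iff]
    intro i
    rw [← Ideal.Quotient.eq_zero_iff_mem, ← Polynomial.coeff_map, h0, Polynomial.coeff_zero]
  obtain ⟨x, hx⟩ : ∃ x, (f.map (Ideal.Quotient.mk P)).eval x ≠ 0 := by
    by_contra! h
    exact hne (Polynomial.funext fun x => by rw [h x, Polynomial.eval_zero])
  obtain ⟨a, rfl⟩ := Ideal.Quotient.mk_surjective x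
  refine ⟨a, fun h => hx ?_⟩
  rw [Polynomial.eval_map_apply]
  exact Ideal.Quotient.eq_zero_iff_mem.2 h

/-- The extra step in height is the strict inclusion of `P[X]` in the prime of all polynomials whose
value at a point `a` lies in `P`. The point is chosen so that the value of `f` there stays outside
`P`. -/
theorem RaisesHeight.polynomial (K : Type*) {A B : Type*} [Field K] [Infinite K] [CommRing A]
    [CommRing B] [IsNoetherianRing B] [Algebra K B] [Algebra A B] {n : ℕ}
    (h : RaisesHeight A B n) : RaisesHeight A (Polynomial B) (n + 1) := by
  intro p f hp hf
  have h1 : algebraMap A (Polynomial B) = (Polynomial.C : B →+* _).comp (algebraMap A B) := rfl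
  rw [h1, ← Ideal.map_map, Ideal.mem_map_C_iff] at hf
  push Not at hf
  obtain ⟨i, hi⟩ := hf
  -- A prime avoiding one coefficient of `f` suffices: then `f` is not in `P[X]`.
  obtain ⟨P, hP, hfP, hh⟩ := h p _ hp hi
  obtain ⟨a, ha⟩ := exists_eval_notMem K P f fun hmem => hfP (Ideal.mem_map_C_iff.1 hmem i)
  let P₀ : Ideal (Polynomial B) := P.map Polynomial.C
  let P₁ : Ideal (Polynomial B) := P.comap (Polynomial.evalRingHom a)
  have hP₀ : P₀.IsPrime := Ideal.isPrime_map_C_of_isPrime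
  have hP₁ : P₁.IsPrime := Ideal.comap_isPrime _ _
  have hlies : P₀.LiesOver P := ⟨by
    ext b
    rw [Ideal.mem_comap]
    change b ∈ P ↔ Polynomial.C b ∈ P.map Polynomial.C
    rw [Ideal.mem_map_C_iff]
    refine ⟨fun hb i => ?_, fun hb => by simpa using hb 0⟩
    rw [Polynomial.coeff_C]
    split_ifs
    · exact hb
    · exact P.zero_mem⟩
  -- Chains below `P` lift to chains below `P[X]` by going down.
  have hht : P.height ≤ P₀.height := by
    rw [Ideal.height_eq_height_add_of_liesOver_of_hasGoingDown P P₀]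
    exact le_self_add
  have hlt : P₀ < P₁ := by
    refine lt_of_le_of_ne (Ideal.map_le_iff_le_comap.2 fun b hb => ?_) fun heq => ?_
    · simpa [P₁] using hb
    · have hX : (Polynomial.X - Polynomial.C a : Polynomial B) ∈ P₁ := by simp [P₁]
      rw [← heq] at hX
      have := Ideal.mem_map_C_iff.1 hX 1
      simp only [Polynomial.coeff_sub, Polynomial.coeff_X_one, Polynomial.coeff_C_succ,
        sub_zero] at this
      exact hP.ne_top ((Ideal.eq_top_iff_one _).2 this)
  refine ⟨P₁, hP₁, ha, ?_⟩
  calc p.height + ((n + 1 : ℕ) : ℕ∞) = p.height + n + 1 := by push_cast; rw [add_assoc]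
    _ ≤ P₀.height + 1 := by gcongr; exact hh.trans hht
    _ ≤ P₁.height := Ideal.height_add_one_le_of_lt_of_isPrime hlt

theorem raisesHeight_mvPolynomial (K A : Type*) [Field K] [Infinite K] [CommRing A]
    [IsNoetherianRing A] [Algebra K A] (ι : Type*) [Finite ι] :
    RaisesHeight A (MvPolynomial ι A) (Nat.card ι) := by
  induction ι using Finite.induction_empty_option with
  | of_equiv e ih =>
    rw [← Nat.card_congr e]
    exact ih.of_algEquiv (MvPolynomial.renameEquiv A e.symm)
  | h_empty =>
    rw [Nat.card_of_isEmpty]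
    exact (RaisesHeight.self A).of_algEquiv (MvPolynomial.isEmptyAlgEquiv A PEmpty)
  | h_option ih =>
    rw [Finite.card_option]
    exact (ih.polynomial K).of_algEquiv (MvPolynomial.optionEquivLeft A _)

theorem mem_map_C_of_isPrime {A ι : Type*} [CommRing A] (p : Ideal A) [p.IsPrime] :
    (p.map (MvPolynomial.C : A →+* MvPolynomial ι A)).IsPrime := by
  rw [← Ideal.Quotient.isDomain_iff_prime]
  exact (MvPolynomial.quotientEquivQuotientMvPolynomial p).symm.injective.isDomain

/-- Heights in the localization are heights in the polynomial ring, which bounds the dimension from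
above. From below, each prime `p` of `A` yields a prime avoiding `f` of height at least that of `p`
plus the number of variables. Here it matters that `f` vanishes identically on no fiber, since a
prime of large height could otherwise be lost. -/
theorem ringKrullDim_away_mvPolynomial (K : Type*) {A ι : Type*} [Field K] [Infinite K]
    [CommRing A] [IsNoetherianRing A] [Algebra K A] [Finite ι] (f : MvPolynomial ι A)
    (hf : ∀ p : Ideal A, p.IsPrime → f ∉ p.map MvPolynomial.C) :
    ringKrullDim (Localization.Away f) = ringKrullDim A + Nat.card ι := by
  apply le_antisymm
  · rw [← MvPolynomial.ringKrullDim_of_isNoetherianRing, ringKrullDim_le_iff_height_le]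
    intro P hP
    rw [← IsLocalization.height_under (Submonoid.powers f) P]
    have : (P.under (MvPolynomial ι A)).IsPrime := Ideal.comap_isPrime _ _
    exact Ideal.height_le_ringKrullDim_of_isPrime
  -- The zero ring is the coordinate ring of an empty stratum, whose dimension is `⊥`.
  · cases subsingleton_or_nontrivial A
    · rw [ringKrullDim_eq_bot_of_subsingleton]
      simp
    have key : ∀ p : Ideal A, p.IsPrime →
        ((p.height + Nat.card ι : ℕ∞) : WithBot ℕ∞) ≤ ringKrullDim (Localization.Away f) := by
      intro p hp
      obtain ⟨P, hP, hfP, hh⟩ := raisesHeight_mvPolynomial K A ι p f hp (hf p hp)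
      have hdis : Disjoint (Submonoid.powers f : Set (MvPolynomial ι A)) P := by
        rw [Set.disjoint_left]
        rintro _ ⟨k, rfl⟩ hk
        exact hfP (hP.mem_of_pow_mem k hk)
      have := IsLocalization.isPrime_of_isPrime_disjoint (Submonoid.powers f)
        (Localization.Away f) P hP hdis
      refine le_trans ?_ (Ideal.height_le_ringKrullDim_of_isPrime
        (I := P.map (algebraMap _ (Localization.Away f))))
      rw [IsLocalization.height_map_of_disjoint (Submonoid.powers f) P hdis]
      exact WithBot.coe_le_coe.2 hh
    obtain ⟨m, hm⟩ := Ideal.exists_maximal A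
    have h0 := key m hm.isPrime
    -- Once `⊥` is excluded, the comparison takes place in `ℕ∞`, where adding a constant commutes
    -- with a nonempty supremum.
    have hne : ringKrullDim (Localization.Away f) ≠ ⊥ := fun h => by simp [h] at h0
    obtain ⟨D, hD⟩ := WithBot.ne_bot_iff_exists.1 hne
    have : Nonempty (Subtype (Ideal.IsPrime (α := A))) := ⟨⟨m, hm.isPrime⟩⟩
    rw [← Ideal.sup_isPrime_height_eq_ringKrullDim, ← hD]
    simp only [← hD] at key
    have hcast : ((Nat.card ι : ℕ) : WithBot ℕ∞) = ((Nat.card ι : ℕ∞) : WithBot ℕ∞) := rfl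
    rw [hcast, ← WithBot.coe_add, WithBot.coe_le_coe, iSup_subtype', ENat.iSup_add]
    exact iSup_le fun p => WithBot.coe_le_coe.1 (key p.1 p.2)

theorem smooth_away_mvPolynomial {A ι : Type*} [CommRing A] [Finite ι] (f : MvPolynomial ι A) :
    (algebraMap A (Localization.Away f)).Smooth := by
  have h1 : Algebra.Smooth A (MvPolynomial ι A) := ⟨inferInstance, inferInstance⟩
  rw [RingHom.smooth_algebraMap]
  exact Algebra.Smooth.comp A (MvPolynomial ι A) (Localization.Away f)

/-- The extension of the prime of `x` to the polynomial ring is a prime that avoids `f`, and it is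
contained in every prime over `x`. It is a generic point of the fiber, which lies between this point
and its closure. In particular the fiber is nonempty. -/
theorem isConnected_fiber_away_mvPolynomial {A ι : Type*} [CommRing A] (f : MvPolynomial ι A)
    (hf : ∀ p : Ideal A, p.IsPrime → f ∉ p.map MvPolynomial.C) (x : PrimeSpectrum A) :
    _root_.IsConnected (PrimeSpectrum.comap (algebraMap A (Localization.Away f)) ⁻¹' {x}) := by
  classical
  let P : Ideal (MvPolynomial ι A) := x.asIdeal.map MvPolynomial.C
  have hP : P.IsPrime := mem_map_C_of_isPrime _
  have hdis : Disjoint (Submonoid.powers f : Set (MvPolynomial ι A)) P := by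
    rw [Set.disjoint_left]
    rintro _ ⟨k, rfl⟩ hk
    exact hf _ x.2 (hP.mem_of_pow_mem k hk)
  have hη := IsLocalization.isPrime_of_isPrime_disjoint (Submonoid.powers f)
    (Localization.Away f) P hP hdis
  let η : PrimeSpectrum (Localization.Away f) := ⟨_, hη⟩
  have hmap : algebraMap A (Localization.Away f) =
      (algebraMap (MvPolynomial ι A) (Localization.Away f)).comp MvPolynomial.C :=
    IsScalarTower.algebraMap_eq A (MvPolynomial ι A) (Localization.Away f)
  have hηx : PrimeSpectrum.comap (algebraMap A (Localization.Away f)) η = x := by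
    ext a
    have hc : Ideal.comap (algebraMap _ (Localization.Away f)) η.asIdeal = P :=
      IsLocalization.under_map_of_isPrime_disjoint (Submonoid.powers f) _ hP hdis
    rw [PrimeSpectrum.comap_asIdeal, hmap, ← Ideal.comap_comap, hc, Ideal.mem_comap, MvPolynomial.mem_map_C_iff]
    refine ⟨fun h => by simpa using h 0, fun h m => ?_⟩
    rw [MvPolynomial.coeff_C]
    split_ifs
    · exact h
    · exact Ideal.zero_mem _
  refine (isConnected_singleton (x := η)).subset_closure
    (Set.singleton_subset_iff.2 hηx) fun y hy => ?_
  rw [PrimeSpectrum.closure_singleton, PrimeSpectrum.mem_zeroLocus]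
  change P.map _ ≤ y.asIdeal
  rw [Ideal.map_map, ← hmap, Ideal.map_le_iff_le_comap]
  have : PrimeSpectrum.comap (algebraMap A (Localization.Away f)) y = x := hy
  rw [← this]
  rfl

/-! ### Hyperplanes of paving matroids -/

section Paving

variable {d n : ℕ} {Q : Matroid (Fin n)}

theorem IsPaving.indep_of_card_lt (hpav : IsPaving d Q) (hE : Q.E = Set.univ)
    {s : Finset (Fin n)} (hs : s.card < d) : Q.Indep (s : Set (Fin n)) := by
  by_contra h
  obtain ⟨C, hCs, hC⟩ := ((Matroid.not_indep_iff
    (by rw [hE]; exact Set.subset_univ _)).1 h).exists_isCircuit_subset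
  have h1 := (hpav C hC).trans (Set.encard_le_encard hCs)
  rw [Set.encard_coe_eq_coe_finsetCard] at h1
  have h2 : d ≤ s.card := by exact_mod_cast h1
  omega

theorem eRk_eq_card (hE : Q.E = Set.univ) (hpav : IsPaving d Q) {s : Finset (Fin n)}
    (hs : s.card < d) : Q.eRk (s : Set (Fin n)) = s.card := by
  rw [(hpav.indep_of_card_lt hE hs).eRk_eq_encard, Set.encard_coe_eq_coe_finsetCard]

theorem IsCyclicHyperplane.eRk_eq {η : Finset (Fin n)} (hη : IsCyclicHyperplane d Q η) :
    Q.eRk (η : Set (Fin n)) = (d - 1 : ℕ) := by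
  obtain ⟨-, h, -⟩ := hη
  obtain ⟨k, hk⟩ : ∃ k : ℕ, Q.eRk (η : Set (Fin n)) = k :=
    ⟨_, (ENat.natCast_toNat fun h' => by simp [h'] at h).symm⟩
  rw [hk] at h ⊢
  have : k + 1 = d := by exact_mod_cast h
  simp [← this]

theorem IsCyclicHyperplane.pos {η : Finset (Fin n)} (hη : IsCyclicHyperplane d Q η) : 0 < d := by
  obtain ⟨-, h, -⟩ := hη
  rcases Nat.eq_zero_or_pos d with rfl | h0
  · simp at h
  · exact h0

/-- By paving, `d - 1` elements are independent, so they have the full rank of the flat `η`. -/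
theorem IsCyclicHyperplane.closure_eq (hE : Q.E = Set.univ) (hpav : IsPaving d Q)
    {η s : Finset (Fin n)} (hη : IsCyclicHyperplane d Q η) (hs : s ⊆ η) (hcard : s.card + 1 = d) :
    Q.closure (s : Set (Fin n)) = η := by
  rw [← hη.1.closure]
  refine Matroid.IsRkFinite.closure_eq_closure_of_subset_of_eRk_ge_eRk
    (Q.isRkFinite_of_finite s.finite_toSet) (by exact_mod_cast hs) ?_
  rw [eRk_eq_card hE hpav (s := s) (by omega), hη.eRk_eq]
  exact_mod_cast (by omega)

/-- The part of `l` on `η` is independent with closure `η`, and the remaining element lies outside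
that closure. -/
theorem IsCyclicHyperplane.isBase_of_card_inter (hE : Q.E = Set.univ) (hd : Q.eRank = d)
    (hpav : IsPaving d Q) {η l : Finset (Fin n)} (hη : IsCyclicHyperplane d Q η)
    (hl : l.card = d) (hlη : (l ∩ η).card + 1 = d) : Q.IsBase (l : Set (Fin n)) := by
  have hcl := hη.closure_eq hE hpav (Finset.inter_subset_right (s₁ := l)) hlη
  have hind := hpav.indep_of_card_lt hE (s := l ∩ η) (by omega)
  obtain ⟨j, hj⟩ : ∃ j, l \ η = {j} := by
    rw [← Finset.card_eq_one]
    have := Finset.card_sdiff_add_card_inter l η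
    omega
  have hjη : j ∈ l ∧ j ∉ η := by
    rw [← Finset.mem_sdiff, hj, Finset.mem_singleton]
  have hins : insert j (l ∩ η) = l := by
    ext x
    simp only [Finset.mem_insert, Finset.mem_inter]
    constructor
    · rintro (rfl | h)
      exacts [hjη.1, h.1]
    · intro hx
      by_cases hxη : x ∈ η
      · exact Or.inr ⟨hx, hxη⟩
      · left
        rw [← Finset.mem_singleton, ← hj, Finset.mem_sdiff]
        exact ⟨hx, hxη⟩
  have hl' : Q.Indep (l : Set (Fin n)) := by
    rw [← hins, Finset.coe_insert]
    refine (hind.insert_indep_iff).2 (Or.inl ⟨by rw [hE]; trivial, ?_⟩)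
    rw [hcl]
    exact_mod_cast hjη.2
  refine hl'.isBase_of_eRk_ge l.finite_toSet ?_
  rw [hd, hl'.eRk_eq_encard, Set.encard_coe_eq_coe_finsetCard, hl]

theorem IsCyclicHyperplane.not_isBase (hd : Q.eRank = d) {η l : Finset (Fin n)}
    (hη : IsCyclicHyperplane d Q η) (hlη : l ⊆ η) : ¬ Q.IsBase (l : Set (Fin n)) := by
  intro h
  have h1 := Q.eRk_mono (show (l : Set (Fin n)) ⊆ η by exact_mod_cast hlη)
  rw [h.eRk_eq_eRank, hd, hη.eRk_eq] at h1
  have h2 : d ≤ d - 1 := by exact_mod_cast h1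
  have := hη.pos
  omega

/-- Deleting one element leaves `d - 1` independent ones. This is why the corank vector takes only
the values 0 and 1 on `d`-sets. -/
theorem eRk_of_not_isBase (hE : Q.E = Set.univ) (hd : Q.eRank = d) (hpav : IsPaving d Q)
    {l : Finset (Fin n)} (hl : l.card = d) (hb : ¬ Q.IsBase (l : Set (Fin n))) :
    Q.eRk (l : Set (Fin n)) + 1 = d := by
  have hpos : 0 < d := by
    rcases Nat.eq_zero_or_pos d with rfl | h
    · exfalso
      apply hb
      refine Matroid.Indep.isBase_of_eRk_ge ?_ l.finite_toSet (by rw [hd]; simp)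
      rw [Finset.card_eq_zero.1 hl]
      simp
    · exact h
  have hne : l.Nonempty := Finset.card_pos.1 (by omega)
  obtain ⟨i, hi⟩ := hne
  have hle : ((d - 1 : ℕ) : ℕ∞) ≤ Q.eRk (l : Set (Fin n)) := by
    have h1 := Q.eRk_mono (show ((l.erase i : Finset (Fin n)) : Set (Fin n)) ⊆ l by
      exact_mod_cast Finset.erase_subset i l)
    rw [eRk_eq_card hE hpav (by rw [Finset.card_erase_of_mem hi]; omega),
      Finset.card_erase_of_mem hi, hl] at h1
    exact h1
  have hlt : Q.eRk (l : Set (Fin n)) < d := by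
    rw [← hl, ← Set.encard_coe_eq_coe_finsetCard]
    refine lt_of_le_of_ne (Q.eRk_le_encard _) fun h => hb ?_
    have hind := (Matroid.indep_iff_eRk_eq_encard_of_finite l.finite_toSet).2 h
    refine hind.isBase_of_eRk_ge l.finite_toSet ?_
    rw [hd, h, Set.encard_coe_eq_coe_finsetCard, hl]
  obtain ⟨k, hk⟩ : ∃ k : ℕ, Q.eRk (l : Set (Fin n)) = k :=
    ⟨_, (ENat.natCast_toNat fun h' => by simp [h'] at hlt).symm⟩
  rw [hk] at hle hlt ⊢
  have h1 : d - 1 ≤ k := by exact_mod_cast hle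
  have h2 : k < d := by exact_mod_cast hlt
  exact_mod_cast (show k + 1 = d by omega)

/-- The closure of `l` works. It has no coloop `e`, because `d - 1` elements of `l` different from
`e` already span it. -/
theorem exists_isCyclicHyperplane (hE : Q.E = Set.univ) (hd : Q.eRank = d) (hpav : IsPaving d Q)
    {l : Finset (Fin n)} (hl : l.card = d) (hb : ¬ Q.IsBase (l : Set (Fin n))) :
    ∃ η : Finset (Fin n), IsCyclicHyperplane d Q η ∧ l ⊆ η := by
  classical
  have hrk := eRk_of_not_isBase hE hd hpav hl hb
  let η : Finset (Fin n) := (Q.closure (l : Set (Fin n))).toFinset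
  have hη : (η : Set (Fin n)) = Q.closure l := by simp [η]
  have hlη : l ⊆ η := by
    rw [← Finset.coe_subset, hη]
    exact Q.subset_closure _ (by rw [hE]; exact Set.subset_univ _)
  refine ⟨η, ⟨by rw [hη]; exact Q.isFlat_closure _, by rw [hη, Q.eRk_closure_eq, hrk], ?_⟩, hlη⟩
  intro e he
  rw [Matroid.restrict_isColoop_iff (by rw [hE]; exact Set.subset_univ _)] at he
  obtain ⟨hecl, heη⟩ := he
  have hpos : 0 < d := by
    rcases Nat.eq_zero_or_pos d with rfl | h
    · simp at hrk
    · exact h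
  -- a subset of `η` with `d - 1` elements that avoids `e`
  obtain ⟨s, hs, hcard⟩ : ∃ s ⊆ l.erase e, s.card = d - 1 := by
    refine Finset.exists_subset_card_eq ?_
    have := Finset.pred_card_le_card_erase (s := l) (a := e)
    omega
  have hsη : (s : Set (Fin n)) ⊆ (η : Set (Fin n)) \ {e} := by
    intro x hx
    have := Finset.mem_erase.1 (hs hx)
    exact ⟨hlη this.2, this.1⟩
  apply hecl
  apply Q.closure_subset_closure hsη
  have : Q.closure (s : Set (Fin n)) = Q.closure (η : Set (Fin n)) := by
    refine Matroid.IsRkFinite.closure_eq_closure_of_subset_of_eRk_ge_eRk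
      (Q.isRkFinite_of_finite s.finite_toSet) (hsη.trans Set.sdiff_subset) ?_
    rw [eRk_eq_card hE hpav (s := s) (by omega), hη, Q.eRk_closure_eq, hcard]
    refine (ENat.add_le_add_iff_right ENat.one_ne_top).1 ?_
    rw [hrk]
    exact_mod_cast (show d ≤ d - 1 + 1 by omega)
  rw [this]
  exact Q.subset_closure _ (by rw [hE]; exact Set.subset_univ _) heη

/-- The two hyperplanes share `d - 1` elements, and these span both. -/
theorem IsCyclicHyperplane.eq_of_card_inter (hE : Q.E = Set.univ) (hpav : IsPaving d Q)
    {η η' l : Finset (Fin n)} (hη : IsCyclicHyperplane d Q η) (hη' : IsCyclicHyperplane d Q η')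
    (hl : l ⊆ η) (h : d ≤ (l ∩ η').card + 1) : η = η' := by
  obtain ⟨s, hs, hcard⟩ : ∃ s ⊆ l ∩ η', s.card = d - 1 :=
    Finset.exists_subset_card_eq (by omega)
  have hpos := hη.pos
  have h1 := hη.closure_eq hE hpav (hs.trans (Finset.inter_subset_left.trans hl)) (by omega)
  have h2 := hη'.closure_eq hE hpav (hs.trans Finset.inter_subset_right) (by omega)
  exact_mod_cast h1.symm.trans h2

/-- A basis adapted to a hyperplane: all elements but the one with index `k` lie on it. -/
theorem IsCyclicHyperplane.exists_adapted (hE : Q.E = Set.univ) (hd : Q.eRank = d)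
    {η : Finset (Fin n)} (hη : IsCyclicHyperplane d Q η) :
    ∃ (β : Fin d → Fin n) (k : Fin d), Function.Injective β ∧ ∀ i, β i ∈ η ↔ i ≠ k := by
  classical
  have hpos := hη.pos
  obtain ⟨I, hI⟩ := Q.exists_isBasis (η : Set (Fin n)) (by rw [hE]; exact Set.subset_univ _)
  have hIcard : I.toFinset.card = d - 1 := by
    have h1 := hI.encard_eq_eRk
    rw [hη.eRk_eq, ← Set.coe_toFinset I, Set.encard_coe_eq_coe_finsetCard] at h1
    exact_mod_cast h1
  obtain ⟨e, he⟩ : ∃ e, e ∉ η := by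
    by_contra! h
    have : (η : Set (Fin n)) = Set.univ := Set.eq_univ_of_forall fun x => h x
    have h1 := hη.eRk_eq
    rw [this, Q.eRk_univ_eq, hd] at h1
    have h2 : d = d - 1 := by exact_mod_cast h1
    omega
  have hIη : ∀ x ∈ I, x ∈ η := fun x hx => by exact_mod_cast hI.subset hx
  have heI : e ∉ I.toFinset := fun h => he (hIη e (by simpa using h))
  have hc : (insert e I.toFinset).card = d := by
    rw [Finset.card_insert_of_notMem heI]; omega
  let f := (insert e I.toFinset).orderEmbOfFin hc
  have hr : ∀ x, x ∈ insert e I.toFinset ↔ ∃ i, f i = x := by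
    intro x
    rw [← Finset.mem_coe, ← Finset.range_orderEmbOfFin _ hc]
    rfl
  obtain ⟨k, hk⟩ := (hr e).1 (Finset.mem_insert_self _ _)
  refine ⟨f, k, f.injective, fun i => ⟨?_, fun hik => ?_⟩⟩
  · rintro hi rfl
    exact he (hk ▸ hi)
  · rcases Finset.mem_insert.1 ((hr (f i)).2 ⟨i, rfl⟩) with h | h
    · exact absurd (f.injective (h.trans hk.symm)) hik
    · exact hIη _ (by simpa using h)

/-! ### Cells of the corank subdivision of a paving matroid -/

theorem corank_of_isBase (hd : Q.eRank = d) {l : Finset (Fin n)}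
    (hl : Q.IsBase (l : Set (Fin n))) : corank d Q l = 0 := by
  rw [corank, hl.eRk_eq_eRank, hd, ENat.toNat_natCast, sub_self]

theorem corank_of_not_isBase (hE : Q.E = Set.univ) (hd : Q.eRank = d) (hpav : IsPaving d Q)
    {l : Finset (Fin n)} (hl : l.card = d) (hb : ¬ Q.IsBase (l : Set (Fin n))) :
    corank d Q l = 1 := by
  have h := eRk_of_not_isBase hE hd hpav hl hb
  obtain ⟨k, hk⟩ : ∃ k : ℕ, Q.eRk (l : Set (Fin n)) = k :=
    ⟨_, (ENat.natCast_toNat fun h' => by simp [h'] at h).symm⟩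
  rw [hk] at h
  have : k + 1 = d := by exact_mod_cast h
  rw [corank, hk, ENat.toNat_natCast, ← this]
  push_cast
  ring

theorem corank_nonneg (hE : Q.E = Set.univ) (hd : Q.eRank = d) (hpav : IsPaving d Q)
    {l : Finset (Fin n)} (hl : l.card = d) : 0 ≤ corank d Q l := by
  by_cases h : Q.IsBase (l : Set (Fin n))
  · rw [corank_of_isBase hd h]
  · rw [corank_of_not_isBase hE hd hpav hl h]; norm_num

theorem corank_le_one (hE : Q.E = Set.univ) (hd : Q.eRank = d) (hpav : IsPaving d Q)
    {l : Finset (Fin n)} (hl : l.card = d) : corank d Q l ≤ 1 := by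
  by_cases h : Q.IsBase (l : Set (Fin n))
  · rw [corank_of_isBase hd h]; norm_num
  · rw [corank_of_not_isBase hE hd hpav hl h]

theorem minimizers_eq {w : Finset (Fin n) → ℝ} {v : Fin n → ℝ} (t : ℝ)
    (hge : ∀ m : Finset (Fin n), m.card = d → t ≤ ∑ i ∈ m, v i + w m)
    (hex : ∃ m : Finset (Fin n), m.card = d ∧ ∑ i ∈ m, v i + w m = t) :
    minimizers d w v = {l | l.card = d ∧ ∑ i ∈ l, v i + w l = t} := by
  obtain ⟨m, hm, hmt⟩ := hex
  ext l
  constructor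
  · rintro ⟨hl, hmin⟩
    exact ⟨hl, le_antisymm (hmt ▸ hmin m hm) (hge l hl)⟩
  · rintro ⟨hl, hlt⟩
    exact ⟨hl, fun m hm => hlt ▸ hge m hm⟩

theorem sum_indicator (η m : Finset (Fin n)) (t : ℝ) :
    ∑ i ∈ m, (if i ∈ η then t else 0) = (m ∩ η).card * t := by
  rw [← Finset.sum_filter, Finset.sum_const, Finset.filter_mem_eq_inter, nsmul_eq_mul]

/-- The `d`-subsets with at least `d - 1` elements on the hyperplane `η`. -/
def hyperplaneSystem (d : ℕ) {n : ℕ} (η : Finset (Fin n))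
    (h : ∃ l : Finset (Fin n), l.card = d ∧ (l ∩ η).card + 1 = d) : BaseSystem d n where
  carrier := {l | l.card = d ∧ d ≤ (l ∩ η).card + 1}
  card_eq _ hl := hl.1
  nonempty := by
    obtain ⟨l, h1, h2⟩ := h
    exact ⟨l, h1, h2.ge⟩

/-- The `d`-subsets with exactly `d - 1` elements on the hyperplane `η`. -/
def wallSystem (d : ℕ) {n : ℕ} (η : Finset (Fin n))
    (h : ∃ l : Finset (Fin n), l.card = d ∧ (l ∩ η).card + 1 = d) : BaseSystem d n where
  carrier := {l | l.card = d ∧ (l ∩ η).card + 1 = d}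
  card_eq _ hl := hl.1
  nonempty := h

theorem IsCyclicHyperplane.exists_wall (hE : Q.E = Set.univ) (hd : Q.eRank = d)
    {η : Finset (Fin n)} (hη : IsCyclicHyperplane d Q η) :
    ∃ l : Finset (Fin n), l.card = d ∧ (l ∩ η).card + 1 = d := by
  obtain ⟨β, k, hβ, hk⟩ := hη.exists_adapted hE hd
  have hpos := hη.pos
  refine ⟨Finset.univ.image β, by rw [Finset.card_image_of_injective _ hβ]; simp, ?_⟩
  have : Finset.univ.image β ∩ η = (Finset.univ.erase k).image β := by
    ext x
    simp only [Finset.mem_inter, Finset.mem_image, Finset.mem_univ, true_and, Finset.mem_erase,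
      and_true]
    constructor
    · rintro ⟨⟨i, rfl⟩, h⟩
      exact ⟨i, (hk i).1 h, rfl⟩
    · rintro ⟨i, h, rfl⟩
      exact ⟨⟨i, rfl⟩, (hk i).2 h⟩
  rw [this, Finset.card_image_of_injective _ hβ, Finset.card_erase_of_mem (Finset.mem_univ _)]
  simp
  omega

/-- These cases decide the minimum of the corank minus `s` times the number of elements on `η`. For
`s = 1` the first two cases tie and beat the third; for `s = 1 / 2` the second alone is minimal. -/
theorem IsCyclicHyperplane.corank_add_ge (hE : Q.E = Set.univ) (hd : Q.eRank = d)
    (hpav : IsPaving d Q) {η m : Finset (Fin n)} (hη : IsCyclicHyperplane d Q η)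
    (hm : m.card = d) :
    ((m ∩ η).card = d ∧ corank d Q m = 1) ∨ ((m ∩ η).card + 1 = d ∧ corank d Q m = 0) ∨
      ((m ∩ η).card + 2 ≤ d ∧ 0 ≤ corank d Q m) := by
  have hle : (m ∩ η).card ≤ d := hm ▸ Finset.card_le_card Finset.inter_subset_left
  rcases (show (m ∩ η).card = d ∨ (m ∩ η).card + 1 = d ∨ (m ∩ η).card + 2 ≤ d by omega)
    with h | h | h
  · refine Or.inl ⟨h, corank_of_not_isBase hE hd hpav hm (hη.not_isBase hd ?_)⟩
    exact Finset.inter_eq_left.1 (Finset.eq_of_subset_of_card_le Finset.inter_subset_left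
      (by omega))
  · exact Or.inr (Or.inl ⟨h, corank_of_isBase hd (hη.isBase_of_card_inter hE hd hpav hm h)⟩)
  · exact Or.inr (Or.inr ⟨h, corank_nonneg hE hd hpav hm⟩)

/-- The cell of the subdivision that lies beyond the hyperplane `η`. -/
def hyperplaneCell (hE : Q.E = Set.univ) (hd : Q.eRank = d) (hpav : IsPaving d Q)
    {η : Finset (Fin n)} (hη : IsCyclicHyperplane d Q η) : Cell (d := d) (corank d Q) :=
  ⟨hyperplaneSystem d η (hη.exists_wall hE hd), fun i => if i ∈ η then -1 else 0, by
    obtain ⟨l, hl, hlη⟩ := hη.exists_wall hE hd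
    -- The minimum: a non-basis on `η` gives `1 - d`, a set of the wall gives `0 - (d - 1)`, and all
    -- other sets give at least `2 - d`.
    rw [minimizers_eq (1 - d : ℝ)]
    · ext m
      simp only [hyperplaneSystem, Set.mem_ofPred_eq, sum_indicator]
      refine and_congr_right fun hm => ?_
      rcases hη.corank_add_ge hE hd hpav hm with ⟨h, h'⟩ | ⟨h, h'⟩ | ⟨h, h'⟩
      · refine iff_of_true (by omega) (by rw [h, h']; ring)
      · refine iff_of_true (by omega) (by rw [h', ← h]; push_cast; ring)
      · refine iff_of_false (by omega) fun h1 => ?_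
        have : ((m ∩ η).card : ℝ) + 2 ≤ d := by exact_mod_cast h
        linarith
    · intro m hm
      rw [sum_indicator]
      rcases hη.corank_add_ge hE hd hpav hm with ⟨h, h'⟩ | ⟨h, h'⟩ | ⟨h, h'⟩
      · rw [h, h']; linarith
      · rw [h', ← h]; push_cast; linarith
      · have : ((m ∩ η).card : ℝ) + 2 ≤ d := by exact_mod_cast h
        linarith
    · refine ⟨l, hl, ?_⟩
      rw [sum_indicator, corank_of_isBase hd (hη.isBase_of_card_inter hE hd hpav hl hlη), ← hlη]
      push_cast
      ring⟩

/-- The common face of the central cell and the cell beyond the hyperplane `η`. -/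
def wallCell (hE : Q.E = Set.univ) (hd : Q.eRank = d) (hpav : IsPaving d Q)
    {η : Finset (Fin n)} (hη : IsCyclicHyperplane d Q η) : Cell (d := d) (corank d Q) :=
  ⟨wallSystem d η (hη.exists_wall hE hd), fun i => if i ∈ η then -(1 / 2) else 0, by
    obtain ⟨l, hl, hlη⟩ := hη.exists_wall hE hd
    -- The minimum: a set of the wall gives `-(d - 1) / 2`, and all other sets give at least `1 - d
    -- / 2`.
    rw [minimizers_eq ((1 - d) / 2 : ℝ)]
    · ext m
      simp only [wallSystem, Set.mem_ofPred_eq, sum_indicator]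
      refine and_congr_right fun hm => ?_
      rcases hη.corank_add_ge hE hd hpav hm with ⟨h, h'⟩ | ⟨h, h'⟩ | ⟨h, h'⟩
      · refine iff_of_false (by omega) fun h1 => ?_
        rw [h, h'] at h1
        linarith
      · refine iff_of_true (by omega) (by rw [h', ← h]; push_cast; ring)
      · refine iff_of_false (by omega) fun h1 => ?_
        have : ((m ∩ η).card : ℝ) + 2 ≤ d := by exact_mod_cast h
        linarith
    · intro m hm
      rw [sum_indicator]
      rcases hη.corank_add_ge hE hd hpav hm with ⟨h, h'⟩ | ⟨h, h'⟩ | ⟨h, h'⟩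
      · rw [h, h']; linarith
      · rw [h', ← h]; push_cast; linarith
      · have : ((m ∩ η).card : ℝ) + 2 ≤ d := by exact_mod_cast h
        linarith
    · refine ⟨l, hl, ?_⟩
      rw [sum_indicator, corank_of_isBase hd (hη.isBase_of_card_inter hE hd hpav hl hlη), ← hlη]
      push_cast
      ring⟩

theorem wallCell_le_centralCell (hE : Q.E = Set.univ) (hd : Q.eRank = d) (hpav : IsPaving d Q)
    {η : Finset (Fin n)} (hη : IsCyclicHyperplane d Q η) :
    wallCell hE hd hpav hη ≤ centralCell Q hd :=
  fun _ hl => hη.isBase_of_card_inter hE hd hpav hl.1 hl.2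

theorem wallCell_le_hyperplaneCell (hE : Q.E = Set.univ) (hd : Q.eRank = d)
    (hpav : IsPaving d Q) {η : Finset (Fin n)} (hη : IsCyclicHyperplane d Q η) :
    wallCell hE hd hpav hη ≤ hyperplaneCell hE hd hpav hη :=
  fun _ hl => ⟨hl.1, hl.2.ge⟩

theorem le_wallCell (hE : Q.E = Set.univ) (hd : Q.eRank = d) (hpav : IsPaving d Q)
    {η : Finset (Fin n)} (hη : IsCyclicHyperplane d Q η) {B : Cell (d := d) (corank d Q)}
    (h1 : B ≤ centralCell Q hd) (h2 : B ≤ hyperplaneCell hE hd hpav hη) :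
    B ≤ wallCell hE hd hpav hη := by
  intro l hl
  have hb : Q.IsBase (l : Set (Fin n)) := h1 hl
  have hc : l.card = d ∧ d ≤ (l ∩ η).card + 1 := h2 hl
  refine ⟨hc.1, ?_⟩
  rcases hη.corank_add_ge hE hd hpav hc.1 with ⟨h, -⟩ | ⟨h, -⟩ | ⟨h, -⟩
  · refine absurd hb (hη.not_isBase hd ?_)
    exact Finset.inter_eq_left.1 (Finset.eq_of_subset_of_card_le Finset.inter_subset_left
      (by omega))
  · exact h
  · omega

theorem exists_not_isBase_of_not_le {hd : Q.eRank = d} {B : Cell (d := d) (corank d Q)}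
    (h : ¬ B ≤ centralCell Q hd) : ∃ l ∈ B.1.carrier, ¬ Q.IsBase (l : Set (Fin n)) := by
  by_contra! h'
  exact h fun l hl => h' l hl

/-- A non-basis in the cell beyond `η` lies entirely on `η`, so one that is also beyond `η'` has `d
- 1` elements common to both hyperplanes. -/
theorem eq_of_le_hyperplaneCell (hE : Q.E = Set.univ) (hd : Q.eRank = d) (hpav : IsPaving d Q)
    {η η' : Finset (Fin n)} (hη : IsCyclicHyperplane d Q η) (hη' : IsCyclicHyperplane d Q η')
    {B : Cell (d := d) (corank d Q)} (h0 : ¬ B ≤ centralCell Q hd)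
    (h1 : B ≤ hyperplaneCell hE hd hpav hη) (h2 : B ≤ hyperplaneCell hE hd hpav hη') :
    η = η' := by
  obtain ⟨l, hl, hb⟩ := exists_not_isBase_of_not_le h0
  have hl1 : l.card = d ∧ d ≤ (l ∩ η).card + 1 := h1 hl
  have hl2 : l.card = d ∧ d ≤ (l ∩ η').card + 1 := h2 hl
  refine hη.eq_of_card_inter hE hpav hη' (l := l) ?_ hl2.2
  rcases hη.corank_add_ge hE hd hpav hl1.1 with ⟨h, -⟩ | ⟨h, -⟩ | ⟨h, -⟩
  · exact Finset.inter_eq_left.1 (Finset.eq_of_subset_of_card_le Finset.inter_subset_left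
      (by omega))
  · exact absurd (hη.isBase_of_card_inter hE hd hpav hl1.1 h) hb
  · omega

/-- If both exchanges in a basis `m` failed, `i` would lie in the closures of `m \ {j₁}` and `m \
{j₂}`, hence in that of `m \ {j₁, j₂}`. Then `d - 1` elements would be dependent. For a non-basis
`m` the corank is already maximal. -/
theorem exists_exchange (hE : Q.E = Set.univ) (hd : Q.eRank = d) (hpav : IsPaving d Q)
    {m : Finset (Fin n)} (hm : m.card = d) {i j₁ j₂ : Fin n} (hi : i ∉ m) (h1 : j₁ ∈ m)
    (h2 : j₂ ∈ m) (h12 : j₁ ≠ j₂) :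
    ∃ j, (j = j₁ ∨ j = j₂) ∧ corank d Q (insert i (m.erase j)) ≤ corank d Q m := by
  have hcard : ∀ j ∈ m, (insert i (m.erase j)).card = d := by
    intro j hj
    rw [Finset.card_insert_of_notMem fun h => hi (Finset.mem_of_mem_erase h),
      Finset.card_erase_of_mem hj, hm]
    have := Finset.card_pos.2 ⟨j, hj⟩
    omega
  by_cases hb : Q.IsBase (m : Set (Fin n))
  · suffices ∃ j, (j = j₁ ∨ j = j₂) ∧
        Q.IsBase ((insert i (m.erase j) : Finset (Fin n)) : Set (Fin n)) by
      obtain ⟨j, hj, hbj⟩ := this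
      exact ⟨j, hj, by rw [corank_of_isBase hd hbj, corank_of_isBase hd hb]⟩
    by_contra! hcon
    have hcl : ∀ j, j ∈ m → (j = j₁ ∨ j = j₂) →
        i ∈ Q.closure ((m : Set (Fin n)) \ {j}) := by
      intro j hjm hj
      by_contra hn
      apply hcon j hj
      have hind : Q.Indep ((insert i (m.erase j) : Finset (Fin n)) : Set (Fin n)) := by
        rw [Finset.coe_insert, Finset.coe_erase]
        exact ((hb.indep.sdiff _).insert_indep_iff).2 (Or.inl ⟨by rw [hE]; trivial, hn⟩)
      refine hind.isBase_of_eRk_ge (Finset.finite_toSet _) ?_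
      rw [hd, hind.eRk_eq_encard, Set.encard_coe_eq_coe_finsetCard, hcard j hjm]
    have hmem : i ∈ Q.closure (((m : Set (Fin n)) \ {j₁}) ∩ ((m : Set (Fin n)) \ {j₂})) := by
      rw [Matroid.Indep.closure_inter_eq_inter_closure
        (hb.indep.subset (Set.union_subset Set.sdiff_subset Set.sdiff_subset))]
      exact ⟨hcl j₁ h1 (Or.inl rfl), hcl j₂ h2 (Or.inr rfl)⟩
    have heq : ((m : Set (Fin n)) \ {j₁}) ∩ ((m : Set (Fin n)) \ {j₂}) =
        (((m.erase j₁).erase j₂ : Finset (Fin n)) : Set (Fin n)) := by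
      ext x
      simp
      tauto
    rw [heq] at hmem
    have hi' : i ∉ (m.erase j₁).erase j₂ := fun h =>
      hi (Finset.mem_of_mem_erase (Finset.mem_of_mem_erase h))
    have hpos := Finset.one_lt_card.2 ⟨j₁, h1, j₂, h2, h12⟩
    have hcard2 : ((m.erase j₁).erase j₂).card = d - 2 := by
      rw [Finset.card_erase_of_mem (Finset.mem_erase.2 ⟨h12.symm, h2⟩),
        Finset.card_erase_of_mem h1, hm]
      omega
    have hind := hpav.indep_of_card_lt hE (s := insert i ((m.erase j₁).erase j₂)) (by
      rw [Finset.card_insert_of_notMem hi', hcard2]; omega)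
    rw [Finset.coe_insert] at hind
    exact (hind.notMem_closure_sdiff_of_mem (Set.mem_insert _ _))
      (by rwa [Set.insert_sdiff_self_of_notMem (by exact_mod_cast hi')])
  · exact ⟨j₁, Or.inl rfl, by
      rw [corank_of_not_isBase hE hd hpav hm hb]
      exact corank_le_one hE hd hpav (hcard j₁ h1)⟩

theorem sum_exchange (v : Fin n → ℝ) {l : Finset (Fin n)} {i j : Fin n} (hi : i ∈ l)
    (hj : j ∉ l) : ∑ x ∈ insert j (l.erase i), v x = ∑ x ∈ l, v x - v i + v j := by
  rw [Finset.sum_insert fun h => hj (Finset.mem_of_mem_erase h), Finset.sum_erase_eq_sub hi]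
  ring

/-- Every cell is a face of the central cell or of the cell beyond some hyperplane. -/
theorem exists_le_hyperplaneCell (hE : Q.E = Set.univ) (hd : Q.eRank = d) (hpav : IsPaving d Q)
    {B : Cell (d := d) (corank d Q)} (h0 : ¬ B ≤ centralCell Q hd) :
    ∃ (η : Finset (Fin n)) (hη : IsCyclicHyperplane d Q η),
      B ≤ hyperplaneCell hE hd hpav hη := by
  obtain ⟨l, hl, hb⟩ := exists_not_isBase_of_not_le h0
  obtain ⟨v, hv⟩ := B.2
  have hlc := B.1.card_eq l hl
  obtain ⟨η, hη, hlη⟩ := exists_isCyclicHyperplane hE hd hpav hlc hb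
  refine ⟨η, hη, fun m hm => ?_⟩
  have hmc := B.1.card_eq m hm
  refine ⟨hmc, ?_⟩
  -- Suppose `m` has two elements off `η`. Trade some `i ∈ l \ m` for a suitable `j ∈ m \ η`. The
  -- sum of the linear terms of the two sets is preserved, the corank of `l` drops from 1 to 0, and
  -- that of `m` does not grow. So one of the new sets beats the minimum.
  by_contra! hlt
  have hsd : 1 < (m \ η).card := by
    have := Finset.card_sdiff_add_card_inter m η
    omega
  obtain ⟨j₁, h1, j₂, h2, h12⟩ := Finset.one_lt_card.1 hsd
  rw [Finset.mem_sdiff] at h1 h2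
  obtain ⟨i, hil, him⟩ : ∃ i ∈ l, i ∉ m := by
    by_contra! h
    have hlm : l = m := Finset.eq_of_subset_of_card_le h (by omega)
    exact h1.2 (hlη (hlm ▸ h1.1))
  obtain ⟨j, hj, hjc⟩ := exists_exchange hE hd hpav hmc him h1.1 h2.1 h12
  have hjm : j ∈ m ∧ j ∉ η := by
    rcases hj with rfl | rfl
    exacts [h1, h2]
  have hjl : j ∉ l := fun h => hjm.2 (hlη h)
  have hpos := Finset.card_pos.2 ⟨i, hil⟩
  have hc1 : (insert j (l.erase i)).card = d := by
    rw [Finset.card_insert_of_notMem fun h => hjl (Finset.mem_of_mem_erase h),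
      Finset.card_erase_of_mem hil]
    omega
  have hc2 : (insert i (m.erase j)).card = d := by
    rw [Finset.card_insert_of_notMem fun h => him (Finset.mem_of_mem_erase h),
      Finset.card_erase_of_mem hjm.1]
    omega
  have hint : insert j (l.erase i) ∩ η = l.erase i := by
    rw [Finset.insert_inter_of_notMem hjm.2]
    exact Finset.inter_eq_left.2 ((Finset.erase_subset _ _).trans hlη)
  have hbase : Q.IsBase ((insert j (l.erase i) : Finset (Fin n)) : Set (Fin n)) := by
    refine hη.isBase_of_card_inter hE hd hpav hc1 ?_
    rw [hint, Finset.card_erase_of_mem hil]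
    omega
  rw [hv] at hl hm
  have e1 := hl.2 _ hc1
  have e2 := hm.2 _ hc2
  rw [sum_exchange v hil hjl, corank_of_isBase hd hbase,
    corank_of_not_isBase hE hd hpav hlc hb] at e1
  rw [sum_exchange v hjm.1 him] at e2
  linarith

end Paving

/-! ### The universal property of the coordinate rings -/

section CoordLift

variable {d n : ℕ} {T : Type*} [CommRing T]

/-- `M` is a matrix with entries in `T` that is normalized at `b` and represents `B`. -/
structure Represents (B : BaseSystem d n) (b : Fin d → Fin n) (M : Matrix (Fin d) (Fin n) T) :
    Prop where
  submatrix_eq_one : M.submatrix id b = 1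
  minor_eq_zero : ∀ c, ¬ B.Mem c → minor M c = 0
  isUnit_minor : ∀ c, B.Mem c → IsUnit (minor M c)

theorem minor_update_of_submatrix_eq_one {M : Matrix (Fin d) (Fin n) T} {b : Fin d → Fin n}
    (h : M.submatrix id b = 1) (i : Fin d) (j : Fin n) :
    minor M (Function.update b i j) = M i j := by
  rw [minor_update_eq_cramer, h, Matrix.cramer_one]
  rfl

theorem apply_of_submatrix_eq_one {M : Matrix (Fin d) (Fin n) T} {b : Fin d → Fin n}
    (h : M.submatrix id b = 1) (i j : Fin d) : M i (b j) = if i = j then 1 else 0 := by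
  have := congrFun (congrFun h i) j
  rwa [Matrix.one_apply] at this

theorem Represents.apply_eq_zero {B : BaseSystem d n} {b : Fin d → Fin n}
    {M : Matrix (Fin d) (Fin n) T} (hM : Represents B b M) {i : Fin d} {j : Fin n}
    (h : ¬ B.Mem (Function.update b i j)) : M i j = 0 := by
  rw [← minor_update_of_submatrix_eq_one hM.submatrix_eq_one, hM.minor_eq_zero _ h]

theorem minor_eq_zero_of_not_injective (M : Matrix (Fin d) (Fin n) T) {c : Fin d → Fin n}
    (hc : ¬ Function.Injective c) : minor M c = 0 := by
  rw [Function.not_injective_iff] at hc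
  obtain ⟨i, j, h, hij⟩ := hc
  exact Matrix.det_zero_of_column_eq hij fun x => by simp [h]

/-- The universal matrix over the coordinate ring. -/
def univMatrix (B : BaseSystem d n) (b : Fin d → Fin n) :
    Matrix (Fin d) (Fin n) (CoordRing B b) :=
  (coordMatrix B b).map (toCoordRing B b)

theorem minor_univMatrix (B : BaseSystem d n) (b c : Fin d → Fin n) :
    minor (univMatrix B b) c = plucker B b c :=
  (map_minor _ _ _).symm

theorem coordMatrix_apply_var {B : BaseSystem d n} {b : Fin d → Fin n} (p : Var B b) :
    coordMatrix B b p.1.1 p.1.2 = MvPolynomial.X p := by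
  have h : b p.1.1 ≠ p.1.2 := fun h => p.2.1 ⟨_, h⟩
  simp [coordMatrix, h, p.2]

theorem univMatrix_apply_var {B : BaseSystem d n} {b : Fin d → Fin n} (p : Var B b) :
    univMatrix B b p.1.1 p.1.2 = toCoordRing B b (MvPolynomial.X p) := by
  rw [univMatrix, Matrix.map_apply, coordMatrix_apply_var]

theorem univMatrix_submatrix (B : BaseSystem d n) {b : Fin d → Fin n}
    (hb : Function.Injective b) : (univMatrix B b).submatrix id b = 1 := by
  ext i j
  by_cases h : i = j
  · subst h; simp [univMatrix, coordMatrix]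
  · simp [univMatrix, coordMatrix, h, hb.eq_iff]

theorem represents_univMatrix (B : BaseSystem d n) {b : Fin d → Fin n}
    (hb : Function.Injective b) : Represents B b (univMatrix B b) where
  submatrix_eq_one := univMatrix_submatrix B hb
  minor_eq_zero c hc := by rw [minor_univMatrix, plucker_eq_zero B b c hc]
  isUnit_minor c hc := by rw [minor_univMatrix]; exact isUnit_plucker B b c hc

theorem Represents.map {S : Type*} [CommRing S] {B : BaseSystem d n} {b : Fin d → Fin n}
    {M : Matrix (Fin d) (Fin n) T} (hM : Represents B b M) (f : T →+* S) :
    Represents B b (M.map f) where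
  submatrix_eq_one := by
    rw [Matrix.submatrix_map, hM.submatrix_eq_one, Matrix.map_one _ (map_zero f) (map_one f)]
  minor_eq_zero c hc := by rw [← map_minor, hM.minor_eq_zero c hc, map_zero]
  isUnit_minor c hc := by rw [← map_minor]; exact (hM.isUnit_minor c hc).map f

/-- Entries of a normalized matrix are minors for single exchanges, so they vanish in `M` wherever
the coordinate matrix has no variable. -/
theorem coordMatrix_map_eval₂Hom {B : BaseSystem d n} {b : Fin d → Fin n}
    (hb : Function.Injective b) (g : ℂ →+* T) {M : Matrix (Fin d) (Fin n) T}
    (hM : Represents B b M) :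
    (coordMatrix B b).map (MvPolynomial.eval₂Hom g fun p : Var B b => M p.1.1 p.1.2) = M := by
  ext i j
  rw [Matrix.map_apply]
  by_cases hj : j ∈ Set.range b
  · obtain ⟨l, rfl⟩ := hj
    rw [apply_of_submatrix_eq_one hM.submatrix_eq_one, coordMatrix, Matrix.of_apply]
    by_cases h : i = l
    · simp [h]
    · simp [h, hb.eq_iff]
  · by_cases hm : B.Mem (Function.update b i j)
    · rw [coordMatrix_apply_var (⟨(i, j), hj, hm⟩ : Var B b), MvPolynomial.coe_eval₂Hom,
        MvPolynomial.eval₂_X]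
    · have hij : b i ≠ j := fun h => hj ⟨i, h⟩
      rw [hM.apply_eq_zero hm]
      simp [coordMatrix, hij, hm]

/-- The homomorphism from the coordinate ring that is given by a representing matrix. -/
def coordLift {B : BaseSystem d n} {b : Fin d → Fin n} (hb : Function.Injective b) (g : ℂ →+* T)
    (M : Matrix (Fin d) (Fin n) T) (hM : Represents B b M) : CoordRing B b →+* T :=
  IsLocalization.lift (M := (coordMonoid B b).map (Ideal.Quotient.mk (coordIdeal B b)))
    (g := Ideal.Quotient.lift (coordIdeal B b)
      (MvPolynomial.eval₂Hom g fun p : Var B b => M p.1.1 p.1.2) (by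
        have : coordIdeal B b ≤
            RingHom.ker (MvPolynomial.eval₂Hom g fun p : Var B b => M p.1.1 p.1.2) := by
          refine Ideal.span_le.2 ?_
          rintro _ ⟨c, hc, rfl⟩
          rw [SetLike.mem_coe, RingHom.mem_ker, map_minor, coordMatrix_map_eval₂Hom hb g hM,
            hM.minor_eq_zero c hc]
        exact fun a ha => RingHom.mem_ker.1 (this ha))) (by
      rintro ⟨_, y, hy, rfl⟩
      have : coordMonoid B b ≤ (IsUnit.submonoid T).comap
          (MvPolynomial.eval₂Hom g fun p : Var B b => M p.1.1 p.1.2).toMonoidHom := by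
        refine Submonoid.closure_le.2 ?_
        rintro _ ⟨c, hc, rfl⟩
        change IsUnit (MvPolynomial.eval₂Hom g (fun p : Var B b => M p.1.1 p.1.2) (minor _ c))
        rw [map_minor, coordMatrix_map_eval₂Hom hb g hM]
        exact hM.isUnit_minor c hc
      exact this hy)

theorem coordLift_toCoordRing {B : BaseSystem d n} {b : Fin d → Fin n}
    (hb : Function.Injective b) (g : ℂ →+* T) (M : Matrix (Fin d) (Fin n) T)
    (hM : Represents B b M) (f : MvPolynomial (Var B b) ℂ) :
    coordLift hb g M hM (toCoordRing B b f) =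
      MvPolynomial.eval₂Hom g (fun p : Var B b => M p.1.1 p.1.2) f := by
  rw [coordLift, toCoordRing, RingHom.comp_apply, IsLocalization.lift_eq, Ideal.Quotient.lift_mk]

theorem coordLift_C {B : BaseSystem d n} {b : Fin d → Fin n} (hb : Function.Injective b)
    (g : ℂ →+* T) (M : Matrix (Fin d) (Fin n) T) (hM : Represents B b M) (z : ℂ) :
    coordLift hb g M hM (toCoordRing B b (MvPolynomial.C z)) = g z := by
  rw [coordLift_toCoordRing, MvPolynomial.coe_eval₂Hom, MvPolynomial.eval₂_C]

theorem univMatrix_map_coordLift {B : BaseSystem d n} {b : Fin d → Fin n}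
    (hb : Function.Injective b) (g : ℂ →+* T) (M : Matrix (Fin d) (Fin n) T)
    (hM : Represents B b M) : (univMatrix B b).map (coordLift hb g M hM) = M := by
  conv_rhs => rw [← coordMatrix_map_eval₂Hom hb g hM]
  ext i j
  simp only [univMatrix, Matrix.map_apply, coordLift_toCoordRing]

theorem coordRing_hom_ext_matrix {B : BaseSystem d n} {b : Fin d → Fin n}
    {f g : CoordRing B b →+* T}
    (hC : ∀ z, f (toCoordRing B b (MvPolynomial.C z)) = g (toCoordRing B b (MvPolynomial.C z)))
    (hX : ∀ i j, j ∉ Set.range b → B.Mem (Function.update b i j) →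
      f (univMatrix B b i j) = g (univMatrix B b i j)) : f = g :=
  coordRing_hom_ext hC fun p => by
    rw [← univMatrix_apply_var]
    exact hX _ _ p.2.1 p.2.2

/-- With a common reference basis, whose Plücker coordinate is 1, these entries are themselves
quotients of Plücker coordinates. -/
theorem faceHom_univMatrix {B' B : BaseSystem d n} (hf : IsFace B' B) {b : Fin d → Fin n}
    (hb : B'.Mem b) {i : Fin d} {j : Fin n} (h : B'.Mem (Function.update b i j)) :
    faceHom hf b b hb (univMatrix B' b i j) = univMatrix B b i j := by
  rw [← minor_update_of_submatrix_eq_one (univMatrix_submatrix B' hb.injective),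
    minor_univMatrix, faceHom_plucker hf b b hb _ h, plucker_self B b hb.injective,
    Ring.inverse_one, mul_one, ← minor_univMatrix,
    minor_update_of_submatrix_eq_one (univMatrix_submatrix B hb.injective)]

end CoordLift

/-! ### Strata beyond a hyperplane -/

section Extension

variable {d n : ℕ} {T : Type*}

theorem card_image_eq_iff (c : Fin d → Fin n) :
    (Finset.univ.image c).card = d ↔ Function.Injective c := by
  have := Finset.card_image_iff (s := Finset.univ) (f := c)
  rw [Finset.card_univ, Fintype.card_fin, Finset.coe_univ, Set.injOn_univ] at this
  exact this

theorem card_image_inter_add (η : Finset (Fin n)) {c : Fin d → Fin n}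
    (hc : Function.Injective c) : (Finset.univ.image c ∩ η).card +
      (Finset.univ.filter fun i => c i ∉ η).card = d := by
  have h1 : Finset.univ.image c ∩ η = (Finset.univ.filter fun i => c i ∈ η).image c := by
    ext x
    simp only [Finset.mem_inter, Finset.mem_image, Finset.mem_univ, true_and, Finset.mem_filter]
    constructor
    · rintro ⟨⟨i, rfl⟩, h⟩
      exact ⟨i, h, rfl⟩
    · rintro ⟨i, h, rfl⟩
      exact ⟨⟨i, rfl⟩, h⟩
  rw [h1, Finset.card_image_of_injective _ hc, Finset.card_filter_add_card_filter_not]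
  simp

theorem wallSystem_mem_iff {η : Finset (Fin n)}
    (h : ∃ l : Finset (Fin n), l.card = d ∧ (l ∩ η).card + 1 = d) (c : Fin d → Fin n) :
    (wallSystem d η h).Mem c ↔ Function.Injective c ∧ ∃ i, ∀ l, c l ∉ η ↔ l = i := by
  change (Finset.univ.image c).card = d ∧ (Finset.univ.image c ∩ η).card + 1 = d ↔ _
  rw [card_image_eq_iff]
  refine and_congr_right fun hc => ?_
  have h1 := card_image_inter_add η hc
  have h2 : (Finset.univ.image c ∩ η).card + 1 = d ↔
      (Finset.univ.filter fun i => c i ∉ η).card = 1 := by omega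
  rw [h2, Finset.card_eq_one]
  simp [Finset.ext_iff]

theorem hyperplaneSystem_mem_iff {η : Finset (Fin n)}
    (h : ∃ l : Finset (Fin n), l.card = d ∧ (l ∩ η).card + 1 = d) (c : Fin d → Fin n) :
    (hyperplaneSystem d η h).Mem c ↔
      Function.Injective c ∧ ∀ i j, c i ∉ η → c j ∉ η → i = j := by
  change (Finset.univ.image c).card = d ∧ d ≤ (Finset.univ.image c ∩ η).card + 1 ↔ _
  rw [card_image_eq_iff]
  refine and_congr_right fun hc => ?_
  have h1 := card_image_inter_add η hc
  have h2 : d ≤ (Finset.univ.image c ∩ η).card + 1 ↔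
      (Finset.univ.filter fun i => c i ∉ η).card ≤ 1 := by omega
  rw [h2, Finset.card_le_one]
  simp only [Finset.mem_filter, Finset.mem_univ, true_and]
  exact ⟨fun h i j hi hj => h i hi j hj, fun h i hi j hj => h i j hi hj⟩

open Classical in
/-- Replace the entries in row `k` and the columns on the hyperplane `η`, but outside the
reference basis `β`, by those of `y`. -/
def extMatrix (η : Finset (Fin n)) (β : Fin d → Fin n) (k : Fin d)
    (M : Matrix (Fin d) (Fin n) T) (y : Fin n → T) : Matrix (Fin d) (Fin n) T :=
  Matrix.of fun i j => if i = k ∧ j ∈ η ∧ j ∉ Set.range β then y j else M i j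

theorem extMatrix_of_ne {η : Finset (Fin n)} {β : Fin d → Fin n} {k : Fin d}
    {M : Matrix (Fin d) (Fin n) T} {y : Fin n → T} {i : Fin d} {j : Fin n} (h : i ≠ k) :
    extMatrix η β k M y i j = M i j :=
  if_neg fun h' => h h'.1

theorem extMatrix_of_notMem {η : Finset (Fin n)} {β : Fin d → Fin n} {k : Fin d}
    {M : Matrix (Fin d) (Fin n) T} {y : Fin n → T} {i : Fin d} {j : Fin n} (h : j ∉ η) :
    extMatrix η β k M y i j = M i j :=
  if_neg fun h' => h h'.2.1

theorem extMatrix_of_mem_range {η : Finset (Fin n)} {β : Fin d → Fin n} {k : Fin d}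
    {M : Matrix (Fin d) (Fin n) T} {y : Fin n → T} {i : Fin d} {j : Fin n}
    (h : j ∈ Set.range β) : extMatrix η β k M y i j = M i j :=
  if_neg fun h' => h'.2.2 h

theorem extMatrix_self {η : Finset (Fin n)} {β : Fin d → Fin n} {k : Fin d}
    {M : Matrix (Fin d) (Fin n) T} {y : Fin n → T} {j : Fin n} (h : j ∈ η)
    (hj : j ∉ Set.range β) : extMatrix η β k M y k j = y j :=
  if_pos ⟨rfl, h, hj⟩

theorem extMatrix_map {S : Type*} [CommRing T] [CommRing S] (f : T →+* S) (η : Finset (Fin n))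
    (β : Fin d → Fin n) (k : Fin d) (M : Matrix (Fin d) (Fin n) T) (y : Fin n → T) :
    (extMatrix η β k M y).map f = extMatrix η β k (M.map f) (f ∘ y) := by
  ext i j
  simp only [extMatrix, Matrix.map_apply, Matrix.of_apply, Function.comp_apply, apply_ite f]

/-- `β` lists a set of `d` elements such that exactly the one with index `k` is not on `η`. -/
structure Adapted (η : Finset (Fin n)) (β : Fin d → Fin n) (k : Fin d) : Prop where
  injective : Function.Injective β
  mem_iff : ∀ i, β i ∈ η ↔ i ≠ k

variable [CommRing T] {η : Finset (Fin n)} {β : Fin d → Fin n} {k : Fin d}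

theorem Adapted.wallSystem_mem (hβ : Adapted η β k)
    (h : ∃ l : Finset (Fin n), l.card = d ∧ (l ∩ η).card + 1 = d) :
    (wallSystem d η h).Mem β :=
  (wallSystem_mem_iff h β).2 ⟨hβ.injective, k, fun l => by rw [hβ.mem_iff, not_not]⟩

theorem Adapted.notMem (hβ : Adapted η β k) : β k ∉ η := fun h => (hβ.mem_iff k).1 h rfl

/-- In a representing matrix of a set of bases each of which has at most one element outside `η`,
the columns outside `η` are supported in row `k`. -/
theorem Adapted.apply_eq_zero_of_notMem (hβ : Adapted η β k) {B : BaseSystem d n}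
    (hB : ∀ c, B.Mem c → ∀ i j, c i ∉ η → c j ∉ η → i = j)
    {M : Matrix (Fin d) (Fin n) T} (hM : Represents B β M) {i : Fin d} {j : Fin n} (hi : i ≠ k)
    (hj : j ∉ η) : M i j = 0 := by
  refine hM.apply_eq_zero fun hm => hi (hB _ hm i k ?_ ?_)
  · rwa [Function.update_self]
  · rw [Function.update_of_ne hi.symm]
    exact hβ.notMem

/-- Exchanging `β k` for an element of `η` leaves no element off `η`, so the result is not in the
wall. -/
theorem Adapted.apply_eq_zero_of_mem (hβ : Adapted η β k)
    {h : ∃ l : Finset (Fin n), l.card = d ∧ (l ∩ η).card + 1 = d}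
    {M : Matrix (Fin d) (Fin n) T} (hM : Represents (wallSystem d η h) β M) {j : Fin n}
    (hj : j ∈ η) : M k j = 0 := by
  refine hM.apply_eq_zero fun hm => ?_
  obtain ⟨-, i, hi⟩ := (wallSystem_mem_iff h _).1 hm
  have h1 := (hi i).2 rfl
  by_cases hik : i = k
  · subst hik
    rw [Function.update_self] at h1
    exact h1 hj
  · rw [Function.update_of_ne hik] at h1
    exact h1 ((hβ.mem_iff i).2 hik)

theorem minor_eq_zero_of_two_columns (N : Matrix (Fin d) (Fin n) T) (k : Fin d)
    {c : Fin d → Fin n} {i j : Fin d} (hij : i ≠ j) (hi : ∀ x, x ≠ k → N x (c i) = 0)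
    (hj : ∀ x, x ≠ k → N x (c j) = 0) : minor N c = 0 := by
  rw [minor, Matrix.det_apply]
  refine Finset.sum_eq_zero fun σ _ => ?_
  have : ∃ l, N (σ l) (c l) = 0 := by
    by_cases h : σ i = k
    · exact ⟨j, hj _ fun h' => hij (σ.injective (h.trans h'.symm))⟩
    · exact ⟨i, hi _ h⟩
  obtain ⟨l, hl⟩ := this
  rw [Finset.prod_eq_zero (Finset.mem_univ l) hl, smul_zero]

theorem wallSystem_at_most_one {h : ∃ l : Finset (Fin n), l.card = d ∧ (l ∩ η).card + 1 = d}
    (c : Fin d → Fin n) (hc : (wallSystem d η h).Mem c) (i j : Fin d) (hi : c i ∉ η)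
    (hj : c j ∉ η) : i = j := by
  obtain ⟨-, l, hl⟩ := (wallSystem_mem_iff h c).1 hc
  exact ((hl i).1 hi).trans ((hl j).1 hj).symm

/-- The single column off `η` is supported in row `k`. Every nonzero term of the Leibniz expansion
uses row `k` there and so misses the replaced entries. -/
theorem Adapted.minor_extMatrix_of_wall (hβ : Adapted η β k)
    {h : ∃ l : Finset (Fin n), l.card = d ∧ (l ∩ η).card + 1 = d}
    {M : Matrix (Fin d) (Fin n) T} (hM : Represents (wallSystem d η h) β M) (y : Fin n → T)
    {c : Fin d → Fin n} (hc : (wallSystem d η h).Mem c) :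
    minor (extMatrix η β k M y) c = minor M c := by
  obtain ⟨-, i, hi⟩ := (wallSystem_mem_iff h c).1 hc
  have hci : c i ∉ η := (hi i).2 rfl
  have hz : ∀ x, x ≠ k → M x (c i) = 0 := fun x hx =>
    hβ.apply_eq_zero_of_notMem wallSystem_at_most_one hM hx hci
  rw [minor, minor, Matrix.det_apply, Matrix.det_apply]
  refine Finset.sum_congr rfl fun σ _ => ?_
  congr 1
  simp only [Matrix.submatrix_apply, id]
  by_cases hσ : σ i = k
  · refine Finset.prod_congr rfl fun l _ => ?_
    by_cases hl : l = i
    · rw [hl, extMatrix_of_notMem hci]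
    · exact extMatrix_of_ne fun h' => hl (σ.injective (h'.trans hσ.symm))
  · rw [Finset.prod_eq_zero (Finset.mem_univ i) (by rw [extMatrix_of_ne hσ]; exact hz _ hσ),
      Finset.prod_eq_zero (Finset.mem_univ i) (hz _ hσ)]

/-- Extending a representing matrix of the wall. -/
theorem Adapted.represents_extMatrix (hβ : Adapted η β k)
    {h : ∃ l : Finset (Fin n), l.card = d ∧ (l ∩ η).card + 1 = d}
    {M : Matrix (Fin d) (Fin n) T} (hM : Represents (wallSystem d η h) β M) (y : Fin n → T)
    (hy : ∀ c : Fin d → Fin n, Function.Injective c → (∀ l, c l ∈ η) →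
      IsUnit (minor (extMatrix η β k M y) c)) :
    Represents (hyperplaneSystem d η h) β (extMatrix η β k M y) where
  submatrix_eq_one := by
    rw [← hM.submatrix_eq_one]
    ext i j
    exact extMatrix_of_mem_range ⟨j, rfl⟩
  minor_eq_zero c hc := by
    by_cases hinj : Function.Injective c
    · have : ∃ i j, c i ∉ η ∧ c j ∉ η ∧ i ≠ j := by
        by_contra! h'
        exact hc ((hyperplaneSystem_mem_iff h c).2 ⟨hinj, h'⟩)
      obtain ⟨i, j, hi, hj, hij⟩ := this
      have hz : ∀ l, c l ∉ η → ∀ x, x ≠ k → extMatrix η β k M y x (c l) = 0 := by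
        intro l hl x hx
        rw [extMatrix_of_ne hx]
        exact hβ.apply_eq_zero_of_notMem wallSystem_at_most_one hM hx hl
      exact minor_eq_zero_of_two_columns _ k hij (hz i hi) (hz j hj)
    · exact minor_eq_zero_of_not_injective _ hinj
  isUnit_minor c hc := by
    obtain ⟨hinj, hone⟩ := (hyperplaneSystem_mem_iff h c).1 hc
    by_cases hall : ∀ l, c l ∈ η
    · exact hy c hinj hall
    · push Not at hall
      obtain ⟨i, hi⟩ := hall
      have hw : (wallSystem d η h).Mem c := (wallSystem_mem_iff h c).2
        ⟨hinj, i, fun l => ⟨fun hl => hone l i hl hi, fun hl => hl ▸ hi⟩⟩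
      rw [hβ.minor_extMatrix_of_wall hM y hw]
      exact hM.isUnit_minor c hw

/-- By counting: `β` has only `d - 1` elements on `η`. Hence a minor with all columns on `η`
involves at least one new entry. -/
theorem Adapted.exists_notMem_range (hβ : Adapted η β k) {c : Fin d → Fin n}
    (hc : Function.Injective c) (hcη : ∀ l, c l ∈ η) : ∃ l, c l ∉ Set.range β := by
  by_contra! h
  choose g hg using h
  have hinj : Function.Injective g := fun a b hab => hc (by rw [← hg a, ← hg b, hab])
  obtain ⟨l, hl⟩ := Finite.surjective_of_injective hinj k
  exact hβ.notMem (hl ▸ (hg l).symm ▸ hcη l)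

open Classical in
/-- A minor of an extended matrix whose columns are on the hyperplane is a linear form in the new
entries; its coefficients are minors of the given matrix. -/
theorem Adapted.minor_extMatrix_single (hβ : Adapted η β k)
    {h : ∃ l : Finset (Fin n), l.card = d ∧ (l ∩ η).card + 1 = d}
    {M : Matrix (Fin d) (Fin n) T} (hM : Represents (wallSystem d η h) β M)
    {c : Fin d → Fin n} (hc : Function.Injective c) (hcη : ∀ l, c l ∈ η) {m : Fin d}
    (hm : c m ∉ Set.range β) :
    minor (extMatrix η β k M fun j => if j = c m then 1 else 0) c =
      minor M (Function.update c m (β k)) := by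
  rw [minor, minor, Matrix.det_apply, Matrix.det_apply]
  refine Finset.sum_congr rfl fun σ _ => ?_
  congr 1
  simp only [Matrix.submatrix_apply, id]
  by_cases hσ : σ m = k
  · refine Finset.prod_congr rfl fun l _ => ?_
    by_cases hl : l = m
    · subst hl
      rw [Function.update_self, hσ, extMatrix_self (hcη l) hm, if_pos rfl,
        apply_of_submatrix_eq_one hM.submatrix_eq_one, if_pos rfl]
    · rw [Function.update_of_ne hl]
      exact extMatrix_of_ne fun h' => hl (σ.injective (h'.trans hσ.symm))
  -- Row `k` now meets a column `l ≠ m` on `η`. Its entry there is 0, either as an entry of the wall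
  -- matrix or by the choice of the new entries.
  · obtain ⟨l, hl⟩ := σ.surjective k
    have hlm : l ≠ m := fun h' => hσ (h' ▸ hl)
    rw [Finset.prod_eq_zero (Finset.mem_univ l), Finset.prod_eq_zero (Finset.mem_univ m)]
    · rw [Function.update_self, apply_of_submatrix_eq_one hM.submatrix_eq_one, if_neg hσ]
    · rw [hl]
      by_cases hr : c l ∈ Set.range β
      · rw [extMatrix_of_mem_range hr, hβ.apply_eq_zero_of_mem hM (hcη l)]
      · rw [extMatrix_self (hcη l) hr, if_neg fun h' => hlm (hc h')]

/-- Replacing one column on `η` by `β k` gives a member of the wall. Such minors are the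
coefficients of the linear forms in the new entries. -/
theorem Adapted.isUnit_minor_update (hβ : Adapted η β k)
    {h : ∃ l : Finset (Fin n), l.card = d ∧ (l ∩ η).card + 1 = d}
    {M : Matrix (Fin d) (Fin n) T} (hM : Represents (wallSystem d η h) β M)
    {c : Fin d → Fin n} (hc : Function.Injective c) (hcη : ∀ l, c l ∈ η) (m : Fin d) :
    IsUnit (minor M (Function.update c m (β k))) := by
  refine hM.isUnit_minor _ ((wallSystem_mem_iff h _).2 ⟨?_, m, fun l => ?_⟩)
  · intro a b hab
    by_cases ha : a = m <;> by_cases hb : b = m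
    · rw [ha, hb]
    · rw [ha, Function.update_self, Function.update_of_ne hb] at hab
      exact absurd (hab ▸ hcη b) hβ.notMem
    · rw [hb, Function.update_self, Function.update_of_ne ha] at hab
      exact absurd (hab ▸ hcη a) hβ.notMem
    · rw [Function.update_of_ne ha, Function.update_of_ne hb] at hab
      exact hc hab
  · by_cases hl : l = m
    · subst hl
      simp [hβ.notMem]
    · simp [hl, hcη l]

/-- A representing matrix of the cell beyond the hyperplane is the extension of its restriction to
the wall. -/
theorem Adapted.extMatrix_eq (hβ : Adapted η β k)
    {h : ∃ l : Finset (Fin n), l.card = d ∧ (l ∩ η).card + 1 = d}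
    {M N : Matrix (Fin d) (Fin n) T} (hM : Represents (wallSystem d η h) β M)
    (hN : Represents (hyperplaneSystem d η h) β N)
    (hMN : ∀ i j, (wallSystem d η h).Mem (Function.update β i j) → M i j = N i j) :
    extMatrix η β k M (N k) = N := by
  ext i j
  by_cases hr : j ∈ Set.range β
  · obtain ⟨l, rfl⟩ := hr
    rw [extMatrix_of_mem_range ⟨l, rfl⟩, apply_of_submatrix_eq_one hM.submatrix_eq_one,
      apply_of_submatrix_eq_one hN.submatrix_eq_one]
  by_cases hk : i = k ∧ j ∈ η
  · obtain ⟨rfl, hj⟩ := hk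
    exact extMatrix_self hj hr
  rw [show extMatrix η β k M (N k) i j = M i j from if_neg fun h' => hk ⟨h'.1, h'.2.1⟩]
  by_cases hw : (wallSystem d η h).Mem (Function.update β i j)
  · exact hMN i j hw
  rw [hM.apply_eq_zero hw, hN.apply_eq_zero]
  intro hm
  obtain ⟨hinj, hone⟩ := (hyperplaneSystem_mem_iff h _).1 hm
  apply hw
  refine (wallSystem_mem_iff h _).2 ⟨hinj, ?_⟩
  suffices ∃ l, Function.update β i j l ∉ η by
    obtain ⟨l, hl⟩ := this
    exact ⟨l, fun l' => ⟨fun h' => hone _ _ h' hl, fun h' => h' ▸ hl⟩⟩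
  by_cases hik : i = k
  · refine ⟨i, ?_⟩
    rw [Function.update_self]
    exact fun hj => hk ⟨hik, hj⟩
  · refine ⟨k, ?_⟩
    rw [Function.update_of_ne (Ne.symm hik)]
    exact hβ.notMem

end Extension

/-! ### Colimits over star-shaped posets -/

section Star

variable {J : Type*} [PartialOrder J] {C : Type*} [Category C] (G : J ⥤ C)

/-- A poset is covered by the lower sets of `q` and of the `b i`, such that the lower sets of `q`
and `b i` meet in the lower set of `f i`, and those of different `b i` meet below `q`. -/
structure IsStar {I : Type*} (q : J) (b f : I → J) : Prop where
  le_center : ∀ i, f i ≤ q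
  le_arm : ∀ i, f i ≤ b i
  cover : ∀ j, ¬ j ≤ q → ∃ i, j ≤ b i
  unique : ∀ j i i', ¬ j ≤ q → j ≤ b i → j ≤ b i' → i = i'
  le_inter : ∀ j i, j ≤ q → j ≤ b i → j ≤ f i

variable {I : Type*} {q : J} {b f : I → J} (hs : IsStar q b f) {X : C} (rq : G.obj q ⟶ X)
  (rb : ∀ i, G.obj (b i) ⟶ X)

open Classical in
/-- The components of the cocone on a star-shaped diagram. -/
def starApp (j : J) : G.obj j ⟶ X :=
  if h : j ≤ q then G.map (homOfLE h) ≫ rq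
  else G.map (homOfLE (hs.cover j h).choose_spec) ≫ rb (hs.cover j h).choose

theorem starApp_of_le_center {j : J} (h : j ≤ q) :
    starApp G hs rq rb j = G.map (homOfLE h) ≫ rq :=
  dif_pos h

theorem map_comp_map_comp {j j' j'' : J} (h : j ≤ j') (h' : j' ≤ j'') (r : G.obj j'' ⟶ X) :
    G.map (homOfLE h) ≫ G.map (homOfLE h') ≫ r = G.map (homOfLE (h.trans h')) ≫ r := by
  rw [← Category.assoc, ← G.map_comp]
  rfl

/-- The choice of the arm in `starApp` is immaterial. An element not below `q` determines its arm,
and one below both `q` and `b i` is below `f i`, where the two routes agree. -/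
theorem starApp_of_le_arm
    (hr : ∀ i, G.map (homOfLE (hs.le_center i)) ≫ rq = G.map (homOfLE (hs.le_arm i)) ≫ rb i)
    {j : J} {i : I} (h : j ≤ b i) : starApp G hs rq rb j = G.map (homOfLE h) ≫ rb i := by
  by_cases hq : j ≤ q
  · have hf := hs.le_inter j i hq h
    rw [starApp_of_le_center G hs rq rb hq, ← map_comp_map_comp G hf (hs.le_center i), hr,
      map_comp_map_comp]
  · have : ∀ i' (h' : j ≤ b i'), G.map (homOfLE h') ≫ rb i' = G.map (homOfLE h) ≫ rb i := by
      intro i' h'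
      obtain rfl := hs.unique j i i' hq h h'
      rfl
    rw [starApp, dif_neg hq]
    exact this _ _

/-- The cocone on a star-shaped diagram. -/
def starCocone
    (hr : ∀ i, G.map (homOfLE (hs.le_center i)) ≫ rq = G.map (homOfLE (hs.le_arm i)) ≫ rb i) :
    Cocone G where
  pt := X
  ι :=
    { app := starApp G hs rq rb
      naturality := by
        intro j j' g
        refine Eq.trans ?_ (Category.comp_id (starApp G hs rq rb j)).symm
        have hle : j ≤ j' := leOfHom g
        obtain rfl : g = homOfLE hle := Subsingleton.elim _ _
        by_cases hq : j' ≤ q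
        · rw [starApp_of_le_center G hs rq rb hq,
            starApp_of_le_center G hs rq rb (hle.trans hq), map_comp_map_comp]
        · obtain ⟨i, hi⟩ := hs.cover j' hq
          rw [starApp_of_le_arm G hs rq rb hr hi,
            starApp_of_le_arm G hs rq rb hr (hle.trans hi), map_comp_map_comp] }

theorem starCocone_center
    (hr : ∀ i, G.map (homOfLE (hs.le_center i)) ≫ rq = G.map (homOfLE (hs.le_arm i)) ≫ rb i) :
    (starCocone G hs rq rb hr).ι.app q = rq := by
  refine (starApp_of_le_center G hs rq rb le_rfl).trans ?_
  rw [show homOfLE (le_refl q) = 𝟙 q from Subsingleton.elim _ _, G.map_id, Category.id_comp]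

theorem starCocone_arm
    (hr : ∀ i, G.map (homOfLE (hs.le_center i)) ≫ rq = G.map (homOfLE (hs.le_arm i)) ≫ rb i)
    (i : I) : (starCocone G hs rq rb hr).ι.app (b i) = rb i := by
  refine (starApp_of_le_arm G hs rq rb hr le_rfl).trans ?_
  rw [show homOfLE (le_refl (b i)) = 𝟙 (b i) from Subsingleton.elim _ _, G.map_id,
    Category.id_comp]

/-- The universal property of the colimit of a star-shaped diagram. -/
def starCoconeIsColimit
    (hr : ∀ i, G.map (homOfLE (hs.le_center i)) ≫ rq = G.map (homOfLE (hs.le_arm i)) ≫ rb i)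
    (hdesc : ∀ (Y : C) (tq : G.obj q ⟶ Y) (tb : ∀ i, G.obj (b i) ⟶ Y),
      (∀ i, G.map (homOfLE (hs.le_center i)) ≫ tq = G.map (homOfLE (hs.le_arm i)) ≫ tb i) →
      ∃ φ : X ⟶ Y, rq ≫ φ = tq ∧ ∀ i, rb i ≫ φ = tb i)
    (hext : ∀ (Y : C) (φ ψ : X ⟶ Y), rq ≫ φ = rq ≫ ψ → (∀ i, rb i ≫ φ = rb i ≫ ψ) → φ = ψ) :
    IsColimit (starCocone G hs rq rb hr) := by
  have key : ∀ s : Cocone G, ∃ φ : X ⟶ s.pt, rq ≫ φ = s.ι.app q ∧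
      ∀ i, rb i ≫ φ = s.ι.app (b i) := fun s =>
    hdesc s.pt _ _ fun i => by rw [s.w, s.w]
  choose φ hφq hφb using key
  exact
    { desc := φ
      fac := by
        intro s j
        change starApp G hs rq rb j ≫ φ s = _
        by_cases hq : j ≤ q
        · rw [starApp_of_le_center G hs rq rb hq, Category.assoc, hφq, s.w]
        · obtain ⟨i, hi⟩ := hs.cover j hq
          rw [starApp_of_le_arm G hs rq rb hr hi, Category.assoc, hφb, s.w]
      uniq := by
        intro s m hm
        refine hext _ _ _ ?_ fun i => ?_
        · rw [hφq, ← hm q, starCocone_center]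
          rfl
        · rw [hφb, ← hm (b i), starCocone_arm]
          rfl }

end Star

/-! ### The coordinate ring of the inverse limit -/

section Limit

variable {d n : ℕ} {Q : Matroid (Fin n)}

/-- The cyclic hyperplanes as an index type. -/
abbrev HypIndex (d : ℕ) {n : ℕ} (Q : Matroid (Fin n)) : Type := ↥(cyclicHyperplanes d Q)

theorem HypIndex.isCyclicHyperplane (η : HypIndex d Q) : IsCyclicHyperplane d Q η.1 := by
  classical
  exact (Finset.mem_filter.1 η.2).2

theorem HypIndex.exists_adapted (hE : Q.E = Set.univ) (hd : Q.eRank = d) (η : HypIndex d Q) :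
    ∃ p : (Fin d → Fin n) × Fin d, Adapted η.1 p.1 p.2 := by
  obtain ⟨β, k, h1, h2⟩ := η.isCyclicHyperplane.exists_adapted hE hd
  exact ⟨(β, k), h1, h2⟩

theorem isStar_cells (hE : Q.E = Set.univ) (hd : Q.eRank = d) (hpav : IsPaving d Q) :
    IsStar (centralCell Q hd)
      (fun η : HypIndex d Q => hyperplaneCell hE hd hpav η.isCyclicHyperplane)
      (fun η : HypIndex d Q => wallCell hE hd hpav η.isCyclicHyperplane) where
  le_center η := wallCell_le_centralCell hE hd hpav η.isCyclicHyperplane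
  le_arm η := wallCell_le_hyperplaneCell hE hd hpav η.isCyclicHyperplane
  cover B hB := by
    classical
    obtain ⟨η, hη, h⟩ := exists_le_hyperplaneCell hE hd hpav hB
    exact ⟨⟨η, Finset.mem_filter.2 ⟨Finset.mem_univ _, hη⟩⟩, h⟩
  unique B η η' hB h h' := Subtype.ext (eq_of_le_hyperplaneCell hE hd hpav
    η.isCyclicHyperplane η'.isCyclicHyperplane hB h h')
  le_inter B η h h' := le_wallCell hE hd hpav η.isCyclicHyperplane h h'

variable (hE : Q.E = Set.univ) (hd : Q.eRank = d) (hpav : IsPaving d Q)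

/-- A basis that is adapted to the hyperplane `η`. -/
def adaptedBasis (η : HypIndex d Q) : Fin d → Fin n := (η.exists_adapted hE hd).choose.1

/-- The index of the element of the adapted basis that is not on the hyperplane. -/
def adaptedIndex (η : HypIndex d Q) : Fin d := (η.exists_adapted hE hd).choose.2

theorem adapted (η : HypIndex d Q) :
    Adapted η.1 (adaptedBasis hE hd η) (adaptedIndex hE hd η) :=
  (η.exists_adapted hE hd).choose_spec

/-- The coordinate ring of the stratum of `Q`. -/
abbrev CentralRing (hd : Q.eRank = d) : Type := CoordRing (bases Q hd) (bases Q hd).refBasis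

/-- The set of bases of the wall at `η`. -/
abbrev wall (η : HypIndex d Q) : BaseSystem d n :=
  wallSystem d η.1 (η.isCyclicHyperplane.exists_wall hE hd)

/-- The set of bases of the cell beyond `η`. -/
abbrev beyond (η : HypIndex d Q) : BaseSystem d n :=
  hyperplaneSystem d η.1 (η.isCyclicHyperplane.exists_wall hE hd)

include hpav in
theorem isFace_wall_central (η : HypIndex d Q) : IsFace (wall hE hd η) (bases Q hd) :=
  (cell_le_iff_isFace _ _).1 ((isStar_cells hE hd hpav).le_center η)

include hpav in
theorem isFace_wall_beyond (η : HypIndex d Q) : IsFace (wall hE hd η) (beyond hE hd η) :=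
  (cell_le_iff_isFace _ _).1 ((isStar_cells hE hd hpav).le_arm η)

/-- For this trivial face, `faceHom` between different reference bases is the change of coordinates.
-/
theorem isFace_refl (B : BaseSystem d n) : IsFace B B := ⟨0, fun l => by simp⟩

theorem wall_mem (η : HypIndex d Q) : (wall hE hd η).Mem (adaptedBasis hE hd η) :=
  (adapted hE hd η).wallSystem_mem _

theorem beyond_mem (η : HypIndex d Q) : (beyond hE hd η).Mem (adaptedBasis hE hd η) :=
  ⟨(wall_mem hE hd η).1, (wall_mem hE hd η).2.ge⟩

/-- The wall homomorphism, in adapted coordinates. -/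
def wallHom (η : HypIndex d Q) :
    CoordRing (wall hE hd η) (adaptedBasis hE hd η) →+* CentralRing hd :=
  faceHom (isFace_wall_central hE hd hpav η) _ _ (wall_mem hE hd η)

/-- The universal matrix of the wall, over the coordinate ring of the stratum of `Q`. -/
def wallMatrix (η : HypIndex d Q) : Matrix (Fin d) (Fin n) (CentralRing hd) :=
  (univMatrix (wall hE hd η) (adaptedBasis hE hd η)).map (wallHom hE hd hpav η)

theorem represents_wallMatrix (η : HypIndex d Q) :
    Represents (wall hE hd η) (adaptedBasis hE hd η) (wallMatrix hE hd hpav η) :=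
  (represents_univMatrix _ (adapted hE hd η).injective).map _

/-- The new coordinates: one for each cyclic hyperplane and each element of it that does not belong
to the adapted basis. -/
abbrev NewVar : Type :=
  Σ η : HypIndex d Q, {j : Fin n // j ∈ η.1 ∧ j ∉ Set.range (adaptedBasis hE hd η)}

open Classical in
/-- The matrix of the cell beyond `η`, over the polynomial ring in the new coordinates. -/
def beyondMatrix (η : HypIndex d Q) :
    Matrix (Fin d) (Fin n) (MvPolynomial (NewVar hE hd) (CentralRing hd)) :=
  extMatrix η.1 (adaptedBasis hE hd η) (adaptedIndex hE hd η)
    ((wallMatrix hE hd hpav η).map MvPolynomial.C)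
    fun j => if h : j ∈ η.1 ∧ j ∉ Set.range (adaptedBasis hE hd η) then
      MvPolynomial.X ⟨η, j, h⟩ else 0

open Classical in
/-- The product of the minors that have to be inverted. -/
def newMinors : MvPolynomial (NewVar hE hd) (CentralRing hd) :=
  ∏ η : HypIndex d Q, ∏ c ∈ Finset.univ.filter fun c : Fin d → Fin n =>
    Function.Injective c ∧ ∀ l, c l ∈ η.1, minor (beyondMatrix hE hd hpav η) c

theorem minor_beyondMatrix_notMem (η : HypIndex d Q) {c : Fin d → Fin n}
    (hc : Function.Injective c) (hcη : ∀ l, c l ∈ η.1) (p : Ideal (CentralRing hd))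
    (hp : p.IsPrime) : minor (beyondMatrix hE hd hpav η) c ∉ p.map MvPolynomial.C := by
  classical
  intro hmem
  obtain ⟨m, hm⟩ := (adapted hE hd η).exists_notMem_range hc hcη
  -- Specializing the new entry in one column outside `β` to 1, and those in the other columns to 0,
  -- isolates a coefficient of the linear form. It would lie in `p`, but it is a minor of the wall
  -- and thus a unit. Variables of other hyperplanes do not occur in this minor.
  let ev : MvPolynomial (NewVar hE hd) (CentralRing hd) →+* CentralRing hd :=
    MvPolynomial.eval fun x => if x.2.1 = c m then 1 else 0
  have hC : ev.comp MvPolynomial.C = RingHom.id _ := by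
    ext a
    simp [ev]
  have h1 := Ideal.mem_map_of_mem ev hmem
  rw [Ideal.map_map, hC, Ideal.map_id, map_minor, beyondMatrix, extMatrix_map] at h1
  have h2 : ((wallMatrix hE hd hpav η).map MvPolynomial.C).map ev = wallMatrix hE hd hpav η := by
    ext i j
    exact congrArg (fun g => g (wallMatrix hE hd hpav η i j)) hC
  have h3 : extMatrix η.1 (adaptedBasis hE hd η) (adaptedIndex hE hd η)
      (wallMatrix hE hd hpav η) (ev ∘ fun j =>
        if h : j ∈ η.1 ∧ j ∉ Set.range (adaptedBasis hE hd η) then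
          MvPolynomial.X ⟨η, j, h⟩ else 0) =
      extMatrix η.1 (adaptedBasis hE hd η) (adaptedIndex hE hd η)
        (wallMatrix hE hd hpav η) fun j => if j = c m then 1 else 0 := by
    ext i j
    rw [extMatrix, extMatrix, Matrix.of_apply, Matrix.of_apply]
    by_cases h : i = adaptedIndex hE hd η ∧ j ∈ η.1 ∧ j ∉ Set.range (adaptedBasis hE hd η)
    · rw [if_pos h, if_pos h, Function.comp_apply, dif_pos h.2]
      simp [ev]
    · rw [if_neg h, if_neg h]
  rw [h2, h3, (adapted hE hd η).minor_extMatrix_single (represents_wallMatrix hE hd hpav η)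
    hc hcη hm] at h1
  exact hp.ne_top (Ideal.eq_top_of_isUnit_mem _ h1
    ((adapted hE hd η).isUnit_minor_update (represents_wallMatrix hE hd hpav η) hc hcη m))

theorem newMinors_notMem (p : Ideal (CentralRing hd)) (hp : p.IsPrime) :
    newMinors hE hd hpav ∉ p.map MvPolynomial.C := by
  classical
  have := mem_map_C_of_isPrime (ι := NewVar hE hd) p
  rw [newMinors, Ideal.IsPrime.prod_mem_iff]
  rintro ⟨η, -, h⟩
  rw [Ideal.IsPrime.prod_mem_iff] at h
  obtain ⟨c, hc, h⟩ := h
  obtain ⟨-, hinj, hcη⟩ := Finset.mem_filter.1 hc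
  exact minor_beyondMatrix_notMem hE hd hpav η hinj hcη p hp h

/-- The adapted basis has exactly `d - 1` elements on `η`, so `η` contributes its remaining `|η| -
(d - 1)` elements. -/
theorem card_newVar : Nat.card (NewVar hE hd) =
    ∑ η ∈ cyclicHyperplanes d Q, (η.card + 1 - d) := by
  classical
  rw [Nat.card_sigma, ← Finset.sum_coe_sort (cyclicHyperplanes d Q) fun η => η.card + 1 - d]
  refine Finset.sum_congr rfl fun η _ => ?_
  have ha := adapted hE hd η
  have h1 := card_image_inter_add η.1 ha.injective
  have h2 : (Finset.univ.filter fun i => adaptedBasis hE hd η i ∉ η.1).card = 1 := by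
    rw [Finset.card_eq_one]
    refine ⟨adaptedIndex hE hd η, ?_⟩
    ext i
    simp [ha.mem_iff]
  have h3 := Finset.card_sdiff_add_card_inter η.1 (Finset.univ.image (adaptedBasis hE hd η))
  rw [Finset.inter_comm] at h3
  have h4 : Nat.card {j : Fin n // j ∈ η.1 ∧ j ∉ Set.range (adaptedBasis hE hd η)} =
      (η.1 \ Finset.univ.image (adaptedBasis hE hd η)).card := by
    rw [← Nat.card_eq_finsetCard]
    refine Nat.card_congr (Equiv.subtypeEquivRight fun j => ?_)
    simp
  rw [h4]
  omega

/-- The coordinate ring of the inverse limit. -/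
abbrev LimitRing : Type := Localization.Away (newMinors hE hd hpav)

/-- The matrix of the cell beyond `η` over the coordinate ring of the inverse limit. -/
def limitMatrix (η : HypIndex d Q) : Matrix (Fin d) (Fin n) (LimitRing hE hd hpav) :=
  (beyondMatrix hE hd hpav η).map (algebraMap _ (LimitRing hE hd hpav))

/-- The minors with all columns on `η` divide `newMinors`, which is inverted; the others are
governed by the wall. -/
theorem represents_limitMatrix (η : HypIndex d Q) :
    Represents (beyond hE hd η) (adaptedBasis hE hd η) (limitMatrix hE hd hpav η) := by
  classical
  have h := (adapted hE hd η).represents_extMatrix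
    (((represents_wallMatrix hE hd hpav η).map MvPolynomial.C).map
      (algebraMap (MvPolynomial (NewVar hE hd) (CentralRing hd)) (LimitRing hE hd hpav)))
    (algebraMap (MvPolynomial (NewVar hE hd) (CentralRing hd)) (LimitRing hE hd hpav) ∘
      fun j => if h : j ∈ η.1 ∧ j ∉ Set.range (adaptedBasis hE hd η) then
        MvPolynomial.X ⟨η, j, h⟩ else 0)
  rw [← extMatrix_map] at h
  refine h fun c hc hcη => ?_
  rw [← map_minor]
  refine isUnit_of_dvd_unit (map_dvd _ ?_)
    (IsLocalization.Away.algebraMap_isUnit (newMinors hE hd hpav))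
  have hmem : c ∈ Finset.univ.filter fun c : Fin d → Fin n =>
      Function.Injective c ∧ ∀ l, c l ∈ η.1 := by simp [hc, hcη]
  exact (Finset.dvd_prod_of_mem (fun c => minor (beyondMatrix hE hd hpav η) c) hmem).trans
    (Finset.dvd_prod_of_mem _ (Finset.mem_univ η))

/-- The homomorphism of the stratum of the cell beyond `η`, in adapted coordinates. -/
def armHom (η : HypIndex d Q) :
    CoordRing (beyond hE hd η) (adaptedBasis hE hd η) →+* LimitRing hE hd hpav :=
  coordLift (adapted hE hd η).injective
    (((algebraMap (CentralRing hd) (LimitRing hE hd hpav)).comp (toCoordRing _ _)).comp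
      MvPolynomial.C) _ (represents_limitMatrix hE hd hpav η)

theorem univMatrix_map_armHom (η : HypIndex d Q) :
    (univMatrix (beyond hE hd η) (adaptedBasis hE hd η)).map (armHom hE hd hpav η) =
      limitMatrix hE hd hpav η :=
  univMatrix_map_coordLift _ _ _ _

/-- An exchange within the wall never replaces the element off `η` by one on `η`, so it avoids the
new entries. -/
theorem limitMatrix_apply_of_wall (η : HypIndex d Q) {i : Fin d} {j : Fin n}
    (h : (wall hE hd η).Mem (Function.update (adaptedBasis hE hd η) i j)) :
    limitMatrix hE hd hpav η i j =
      algebraMap (CentralRing hd) (LimitRing hE hd hpav) (wallMatrix hE hd hpav η i j) := by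
  have hne : ¬ (i = adaptedIndex hE hd η ∧ j ∈ η.1) := by
    rintro ⟨rfl, hj⟩
    obtain ⟨-, l, hl⟩ := (wallSystem_mem_iff _ _).1 h
    have h1 := (hl l).2 rfl
    by_cases hli : l = adaptedIndex hE hd η
    · rw [hli, Function.update_self] at h1
      exact h1 hj
    · rw [Function.update_of_ne hli] at h1
      exact h1 (((adapted hE hd η).mem_iff l).2 hli)
  rw [limitMatrix, Matrix.map_apply, beyondMatrix, extMatrix, Matrix.of_apply,
    if_neg fun h' => hne ⟨h'.1, h'.2.1⟩, Matrix.map_apply,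
    IsScalarTower.algebraMap_apply (CentralRing hd)
      (MvPolynomial (NewVar hE hd) (CentralRing hd)) (LimitRing hE hd hpav)]
  rfl

theorem armHom_comp_faceHom (η : HypIndex d Q) :
    (armHom hE hd hpav η).comp
      (faceHom (isFace_wall_beyond hE hd hpav η) _ _ (wall_mem hE hd η)) =
    (algebraMap (CentralRing hd) (LimitRing hE hd hpav)).comp (wallHom hE hd hpav η) := by
  refine coordRing_hom_ext_matrix (fun z => ?_) fun i j _ hij => ?_
  · rw [RingHom.comp_apply, faceHom_C, armHom, coordLift_C, RingHom.comp_apply, RingHom.comp_apply,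
      RingHom.comp_apply, wallHom, faceHom_C]
  · rw [RingHom.comp_apply, faceHom_univMatrix _ _ hij, RingHom.comp_apply]
    have h1 := congrFun (congrFun (univMatrix_map_armHom hE hd hpav η) i) j
    exact h1.trans (limitMatrix_apply_of_wall hE hd hpav η hij)

end Limit

/-! ### The limit ring as colimit of the coordinate rings of the cells -/

section Colimit

variable {d n : ℕ} {Q : Matroid (Fin n)} (hE : Q.E = Set.univ) (hd : Q.eRank = d)
  (hpav : IsPaving d Q)

/-- Passage from the reference coordinates of the cell beyond `η` to the adapted ones. -/
def toAdapted (η : HypIndex d Q) :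
    CoordRing (beyond hE hd η) (beyond hE hd η).refBasis →+*
      CoordRing (beyond hE hd η) (adaptedBasis hE hd η) :=
  faceHom (isFace_refl _) _ _ (beyond hE hd η).refBasis_mem

/-- Passage from the adapted coordinates of the cell beyond `η` to the reference coordinates. -/
def ofAdapted (η : HypIndex d Q) :
    CoordRing (beyond hE hd η) (adaptedBasis hE hd η) →+*
      CoordRing (beyond hE hd η) (beyond hE hd η).refBasis :=
  faceHom (isFace_refl _) _ _ (beyond_mem hE hd η)

theorem toAdapted_comp_ofAdapted (η : HypIndex d Q) :
    (toAdapted hE hd η).comp (ofAdapted hE hd η) = RingHom.id _ := by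
  rw [toAdapted, ofAdapted, faceHom_comp _ _ (isFace_refl _) _ _ _ _
    (beyond hE hd η).refBasis_mem, faceHom_id]

theorem ofAdapted_comp_toAdapted (η : HypIndex d Q) :
    (ofAdapted hE hd η).comp (toAdapted hE hd η) = RingHom.id _ := by
  rw [toAdapted, ofAdapted, faceHom_comp _ _ (isFace_refl _) _ _ _ _ (beyond_mem hE hd η),
    faceHom_id]

/-- The homomorphism of the wall to the cell beyond, in reference coordinates. -/
abbrev wallToBeyond (η : HypIndex d Q) :
    CoordRing (wall hE hd η) (wall hE hd η).refBasis →+*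
      CoordRing (beyond hE hd η) (beyond hE hd η).refBasis :=
  faceHom (isFace_wall_beyond hE hd hpav η) _ _ (wall hE hd η).refBasis_mem

/-- The homomorphism of the wall to the stratum of `Q`, in reference coordinates. -/
abbrev wallToCentral (η : HypIndex d Q) :
    CoordRing (wall hE hd η) (wall hE hd η).refBasis →+* CentralRing hd :=
  faceHom (isFace_wall_central hE hd hpav η) _ _ (wall hE hd η).refBasis_mem

/-- This is `armHom_comp_faceHom` precomposed with the change of coordinates on the wall, by
functoriality of `faceHom`. -/
theorem armHom_compat (η : HypIndex d Q) :
    (algebraMap (CentralRing hd) (LimitRing hE hd hpav)).comp (wallToCentral hE hd hpav η) =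
      ((armHom hE hd hpav η).comp (toAdapted hE hd η)).comp (wallToBeyond hE hd hpav η) := by
  let w : CoordRing (wall hE hd η) (wall hE hd η).refBasis →+*
      CoordRing (wall hE hd η) (adaptedBasis hE hd η) :=
    faceHom (isFace_refl _) _ _ (wall hE hd η).refBasis_mem
  have h1 : wallToCentral hE hd hpav η = (wallHom hE hd hpav η).comp w :=
    (faceHom_comp _ _ _ _ _ _ _ (wall_mem hE hd η)).symm
  have h2 : (toAdapted hE hd η).comp (wallToBeyond hE hd hpav η) =
      (faceHom (isFace_wall_beyond hE hd hpav η) _ _ (wall_mem hE hd η)).comp w := by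
    rw [toAdapted, wallToBeyond, faceHom_comp _ _ (isFace_wall_beyond hE hd hpav η) _ _ _ _
      (beyond hE hd η).refBasis_mem,
      faceHom_comp _ _ (isFace_wall_beyond hE hd hpav η) _ _ _ _ (wall_mem hE hd η)]
  rw [RingHom.comp_assoc, h2, h1, ← RingHom.comp_assoc, ← RingHom.comp_assoc,
    armHom_comp_faceHom]

section Desc

variable {T : Type*} [CommRing T] (t : CentralRing hd →+* T)
  (s : ∀ η : HypIndex d Q, CoordRing (beyond hE hd η) (beyond hE hd η).refBasis →+* T)

/-- The matrix over `T` that is given by a homomorphism on the stratum of the cell beyond `η`. -/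
def targetMatrix (η : HypIndex d Q) : Matrix (Fin d) (Fin n) T :=
  (univMatrix (beyond hE hd η) (adaptedBasis hE hd η)).map ((s η).comp (ofAdapted hE hd η))

theorem represents_targetMatrix (η : HypIndex d Q) :
    Represents (beyond hE hd η) (adaptedBasis hE hd η) (targetMatrix hE hd s η) :=
  (represents_univMatrix _ (adapted hE hd η).injective).map _

/-- The homomorphism of the polynomial ring in the new coordinates. -/
def descPoly : MvPolynomial (NewVar hE hd) (CentralRing hd) →+* T :=
  MvPolynomial.eval₂Hom t fun x => targetMatrix hE hd s x.1 (adaptedIndex hE hd x.1) x.2.1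

variable (hst : ∀ η, t.comp (wallToCentral hE hd hpav η) =
  (s η).comp (wallToBeyond hE hd hpav η))

include hst in
theorem comp_wallHom (η : HypIndex d Q) : t.comp (wallHom hE hd hpav η) =
    ((s η).comp (ofAdapted hE hd η)).comp
      (faceHom (isFace_wall_beyond hE hd hpav η) _ _ (wall_mem hE hd η)) := by
  let w : CoordRing (wall hE hd η) (adaptedBasis hE hd η) →+*
      CoordRing (wall hE hd η) (wall hE hd η).refBasis :=
    faceHom (isFace_refl _) _ _ (wall_mem hE hd η)
  have h1 : wallHom hE hd hpav η = (wallToCentral hE hd hpav η).comp w :=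
    (faceHom_comp _ _ _ _ _ _ _ (wall hE hd η).refBasis_mem).symm
  have h2 : (ofAdapted hE hd η).comp
      (faceHom (isFace_wall_beyond hE hd hpav η) _ _ (wall_mem hE hd η)) =
      (wallToBeyond hE hd hpav η).comp w := by
    rw [ofAdapted, wallToBeyond, faceHom_comp _ _ (isFace_wall_beyond hE hd hpav η) _ _ _ _
      (beyond_mem hE hd η), faceHom_comp _ _ (isFace_wall_beyond hE hd hpav η) _ _ _ _
      (wall hE hd η).refBasis_mem]
  rw [RingHom.comp_assoc, h2, h1, ← RingHom.comp_assoc, ← RingHom.comp_assoc, hst]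

include hst in
-- The target matrix is the extension of its own restriction to the wall by its row `k`. By
-- compatibility that restriction comes from the stratum of `Q`, and `descPoly` sends the new
-- variables to the entries of that row.
theorem beyondMatrix_map_descPoly (η : HypIndex d Q) :
    (beyondMatrix hE hd hpav η).map (descPoly hE hd t s) = targetMatrix hE hd s η := by
  classical
  have hM : Represents (wall hE hd η) (adaptedBasis hE hd η) ((wallMatrix hE hd hpav η).map t) :=
    (represents_wallMatrix hE hd hpav η).map t
  rw [← (adapted hE hd η).extMatrix_eq hM (represents_targetMatrix hE hd s η), beyondMatrix,
    extMatrix_map]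
  · have h1 : ((wallMatrix hE hd hpav η).map MvPolynomial.C).map (descPoly hE hd t s) =
        (wallMatrix hE hd hpav η).map t := by
      ext i j
      simp [descPoly]
    rw [h1]
    ext i j
    rw [extMatrix, extMatrix, Matrix.of_apply, Matrix.of_apply]
    by_cases h : i = adaptedIndex hE hd η ∧ j ∈ η.1 ∧ j ∉ Set.range (adaptedBasis hE hd η)
    · rw [if_pos h, if_pos h, Function.comp_apply, dif_pos h.2]
      simp [descPoly]
    · rw [if_neg h, if_neg h]
  · intro i j hij
    have h1 := RingHom.congr_fun (comp_wallHom hE hd hpav t s hst η)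
      (univMatrix (wall hE hd η) (adaptedBasis hE hd η) i j)
    rw [RingHom.comp_apply, RingHom.comp_apply _ (faceHom _ _ _ _),
      faceHom_univMatrix _ _ hij] at h1
    exact h1

include hst in
theorem isUnit_descPoly_newMinors :
    IsUnit (descPoly hE hd t s (newMinors hE hd hpav)) := by
  classical
  rw [newMinors, map_prod]
  refine (IsUnit.prod_univ_iff).2 fun η => ?_
  rw [map_prod]
  refine IsUnit.prod_iff.2 fun c hc => ?_
  obtain ⟨-, hinj, hcη⟩ := Finset.mem_filter.1 hc
  rw [map_minor, beyondMatrix_map_descPoly hE hd hpav t s hst]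
  exact (represents_targetMatrix hE hd s η).isUnit_minor c
    ((hyperplaneSystem_mem_iff _ c).2 ⟨hinj, fun i j hi => absurd (hcη i) hi⟩)

include hst in
-- Existence in the universal property. The new variables go to matrix entries over `T`, and the
-- inverted minors become minors of representing matrices, which are units.
theorem exists_desc : ∃ φ : LimitRing hE hd hpav →+* T,
    φ.comp (algebraMap (CentralRing hd) (LimitRing hE hd hpav)) = t ∧
      ∀ η, φ.comp ((armHom hE hd hpav η).comp (toAdapted hE hd η)) = s η := by
  let φ : LimitRing hE hd hpav →+* T :=
    IsLocalization.Away.lift (newMinors hE hd hpav) (isUnit_descPoly_newMinors hE hd hpav t s hst)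
  have hφ : ∀ x, φ (algebraMap _ _ x) = descPoly hE hd t s x := fun x =>
    IsLocalization.Away.lift_eq _ _ _
  have hφt : φ.comp (algebraMap (CentralRing hd) (LimitRing hE hd hpav)) = t := by
    ext x
    rw [RingHom.comp_apply, IsScalarTower.algebraMap_apply (CentralRing hd)
      (MvPolynomial (NewVar hE hd) (CentralRing hd)) (LimitRing hE hd hpav), hφ]
    simp [descPoly]
  refine ⟨φ, hφt, fun η => ?_⟩
  have h1 : φ.comp (armHom hE hd hpav η) = (s η).comp (ofAdapted hE hd η) := by
    refine coordRing_hom_ext_matrix (fun z => ?_) fun i j _ _ => ?_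
    -- The homomorphisms are not assumed to be `ℂ`-linear; `t` and `s η` agree on constants because
    -- they agree on the wall.
    · have h2 := RingHom.congr_fun (comp_wallHom hE hd hpav t s hst η)
        (toCoordRing _ _ (MvPolynomial.C z))
      rw [RingHom.comp_apply, RingHom.comp_apply _ (faceHom _ _ _ _), faceHom_C, wallHom,
        faceHom_C] at h2
      rw [RingHom.comp_apply, armHom, coordLift_C, ← h2, ← hφt]
      rfl
    · have h2 := congrFun (congrFun (univMatrix_map_armHom hE hd hpav η) i) j
      have h3 := congrFun (congrFun (beyondMatrix_map_descPoly hE hd hpav t s hst η) i) j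
      rw [Matrix.map_apply] at h2 h3
      rw [RingHom.comp_apply, h2, limitMatrix, Matrix.map_apply, hφ, h3]
      rfl
  rw [← RingHom.comp_assoc, h1, RingHom.comp_assoc, ofAdapted_comp_toAdapted, RingHom.comp_id]

end Desc

/-- Uniqueness in the universal property: each new variable is an entry of a universal matrix beyond
some hyperplane. -/
theorem limitRing_hom_ext {T : Type*} [CommRing T] {φ ψ : LimitRing hE hd hpav →+* T}
    (h : φ.comp (algebraMap (CentralRing hd) (LimitRing hE hd hpav)) =
      ψ.comp (algebraMap (CentralRing hd) (LimitRing hE hd hpav)))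
    (h' : ∀ η, φ.comp ((armHom hE hd hpav η).comp (toAdapted hE hd η)) =
      ψ.comp ((armHom hE hd hpav η).comp (toAdapted hE hd η))) : φ = ψ := by
  classical
  refine IsLocalization.ringHom_ext (Submonoid.powers (newMinors hE hd hpav)) ?_
  refine MvPolynomial.ringHom_ext (fun a => ?_) fun x => ?_
  · have := RingHom.congr_fun h a
    rw [RingHom.comp_apply, RingHom.comp_apply, IsScalarTower.algebraMap_apply (CentralRing hd)
      (MvPolynomial (NewVar hE hd) (CentralRing hd)) (LimitRing hE hd hpav)] at this
    exact this
  · obtain ⟨η, j, hj⟩ := x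
    have h1 : φ.comp (armHom hE hd hpav η) = ψ.comp (armHom hE hd hpav η) := by
      have h2 := congrArg (fun g => g.comp (ofAdapted hE hd η)) (h' η)
      simp only [RingHom.comp_assoc, toAdapted_comp_ofAdapted, RingHom.comp_id] at h2
      exact h2
    have h2 := congrFun (congrFun (univMatrix_map_armHom hE hd hpav η)
      (adaptedIndex hE hd η)) j
    have h3 : beyondMatrix hE hd hpav η (adaptedIndex hE hd η) j =
        MvPolynomial.X ⟨η, j, hj⟩ := by
      rw [beyondMatrix, extMatrix_self hj.1 hj.2, dif_pos hj]
    rw [Matrix.map_apply, limitMatrix, Matrix.map_apply, h3] at h2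
    have h4 := RingHom.congr_fun h1
      (univMatrix (beyond hE hd η) (adaptedBasis hE hd η) (adaptedIndex hE hd η) j)
    rw [RingHom.comp_apply, RingHom.comp_apply] at h4 ⊢
    rw [← h2]
    exact h4

theorem limit_compat (η : HypIndex d Q) :
    (cellRings (corank d Q)).map (homOfLE ((isStar_cells hE hd hpav).le_center η)) ≫
        CommRingCat.ofHom (algebraMap (CentralRing hd) (LimitRing hE hd hpav)) =
      (cellRings (corank d Q)).map (homOfLE ((isStar_cells hE hd hpav).le_arm η)) ≫
        CommRingCat.ofHom ((armHom hE hd hpav η).comp (toAdapted hE hd η)) := by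
  have h := congrArg CommRingCat.ofHom (armHom_compat hE hd hpav η)
  rw [CommRingCat.ofHom_comp, CommRingCat.ofHom_comp _ (RingHom.comp _ _)] at h
  exact h

/-- The cocone that exhibits the limit ring as the colimit of the coordinate rings. -/
abbrev limitCocone : Cocone (cellRings (d := d) (corank d Q)) :=
  starCocone (cellRings (corank d Q)) (isStar_cells hE hd hpav)
    (CommRingCat.ofHom (algebraMap (CentralRing hd) (LimitRing hE hd hpav)))
    (fun η => CommRingCat.ofHom ((armHom hE hd hpav η).comp (toAdapted hE hd η)))
    (limit_compat hE hd hpav)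

/-- The limit ring is the colimit of the coordinate rings of the cells. -/
def limitCoconeIsColimit : IsColimit (limitCocone hE hd hpav) := by
  refine starCoconeIsColimit _ _ _ _ _ (fun Y tq tb hc => ?_) fun Y φ ψ h h' => ?_
  · obtain ⟨φ, h1, h2⟩ := exists_desc hE hd hpav tq.hom (fun η => (tb η).hom) fun η =>
      congrArg CommRingCat.Hom.hom (hc η)
    exact ⟨CommRingCat.ofHom φ, CommRingCat.hom_ext h1, fun η => CommRingCat.hom_ext (h2 η)⟩
  · exact CommRingCat.hom_ext (limitRing_hom_ext hE hd hpav
      (congrArg CommRingCat.Hom.hom h) fun η => congrArg CommRingCat.Hom.hom (h' η))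

/-- The structural morphism to the stratum of `Q` is the projection of a principal open subset of
an affine space. -/
theorem exists_iso_proj : ∃ e : GrLimit d (corank d Q) ≅ Spec (.of (LimitRing hE hd hpav)),
    GrLimit.proj (corank d Q) (centralCell Q hd) =
      e.hom ≫ Spec.map (CommRingCat.ofHom
        (algebraMap (CentralRing hd) (LimitRing hE hd hpav))) := by
  -- `Spec` turns the colimit of rings into a limit of schemes.
  let hlim := isLimitOfPreserves Scheme.Spec (limitCoconeIsColimit hE hd hpav).op
  refine ⟨(limit.isLimit (strataDiagram (corank d Q))).conePointUniqueUpToIso hlim, ?_⟩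
  have h1 := (limit.isLimit (strataDiagram (corank d Q))).conePointUniqueUpToIso_hom_comp hlim
    (Opposite.op (centralCell Q hd))
  have h2 := starCocone_center (cellRings (corank d Q)) (isStar_cells hE hd hpav) _ _
    (limit_compat hE hd hpav)
  refine h1.symm.trans ?_
  congr 1
  exact congrArg Spec.map h2

end Colimit

end MatroidStrata

end

/-! ### Geometry of the structural morphism -/

theorem mainTheorem9 (d n : ℕ) (Q : Matroid (Fin n)) (hE : Q.E = Set.univ) (hd : Q.eRank = d)
    (hpav : MatroidStrata.IsPaving d Q) (hconn : MatroidStrata.IsConnected Q) :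
    AlgebraicGeometry.Smooth (MatroidStrata.GrLimit.proj (MatroidStrata.corank d Q)
      (MatroidStrata.centralCell Q hd)) ∧
    AlgebraicGeometry.Surjective (MatroidStrata.GrLimit.proj (MatroidStrata.corank d Q)
      (MatroidStrata.centralCell Q hd)) ∧
    (∀ x : MatroidStrata.Gr (MatroidStrata.bases Q hd),
      ConnectedSpace ((MatroidStrata.GrLimit.proj (MatroidStrata.corank d Q)
        (MatroidStrata.centralCell Q hd)).fiber x)) ∧
    topologicalKrullDim (MatroidStrata.GrLimit d (MatroidStrata.corank d Q)) =
      topologicalKrullDim (MatroidStrata.Gr (MatroidStrata.bases Q hd)) +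
        ((∑ η ∈ MatroidStrata.cyclicHyperplanes d Q, (η.card + 1 - d) : ℕ) : WithBot ℕ∞) := by
  obtain ⟨e, he⟩ := MatroidStrata.exists_iso_proj hE hd hpav
  -- Nonvanishing on every fiber feeds surjectivity, connectedness and the dimension formula alike.
  have hf := MatroidStrata.newMinors_notMem hE hd hpav
  have hfib : ∀ x : MatroidStrata.Gr (MatroidStrata.bases Q hd),
      _root_.IsConnected ((MatroidStrata.GrLimit.proj (MatroidStrata.corank d Q)
        (MatroidStrata.centralCell Q hd)) ⁻¹' {x}) := by
    intro x
    have h1 := MatroidStrata.isConnected_fiber_away_mvPolynomial _ hf x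
    have h2 := (Scheme.homeoOfIso e).isConnected_preimage.2 h1
    rw [he]
    exact h2
  refine ⟨?_, ⟨fun x => ?_⟩, fun x => ?_, ?_⟩
  · rw [he]
    have : Smooth (Spec.map (CommRingCat.ofHom (algebraMap (MatroidStrata.CentralRing hd)
        (MatroidStrata.LimitRing hE hd hpav)))) :=
      HasRingHomProperty.Spec_iff.2 (MatroidStrata.smooth_away_mvPolynomial _)
    exact @smooth_comp _ _ _ _ _ inferInstance this
  · obtain ⟨y, hy⟩ := (hfib x).nonempty
    exact ⟨y, hy⟩
  -- The scheme-theoretic fiber is homeomorphic to the preimage of the point.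
  · have := isConnected_iff_connectedSpace.1 (hfib x)
    exact ((MatroidStrata.GrLimit.proj (MatroidStrata.corank d Q)
      (MatroidStrata.centralCell Q hd)).fiberHomeo x).symm.surjective.connectedSpace
        (Homeomorph.continuous _)
  -- The ring is a localization of a quotient of a polynomial ring in finitely many variables.
  · have hN : IsNoetherianRing (MatroidStrata.CentralRing hd) :=
      IsLocalization.isNoetherianRing ((MatroidStrata.coordMonoid (MatroidStrata.bases Q hd)
        (MatroidStrata.bases Q hd).refBasis).map (Ideal.Quotient.mk
          (MatroidStrata.coordIdeal (MatroidStrata.bases Q hd)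
            (MatroidStrata.bases Q hd).refBasis))) _ inferInstance
    rw [(Scheme.homeoOfIso e).isHomeomorph.topologicalKrullDim_eq]
    have h1 := MatroidStrata.ringKrullDim_away_mvPolynomial ℂ _ hf
    rw [← PrimeSpectrum.topologicalKrullDim_eq_ringKrullDim,
      ← PrimeSpectrum.topologicalKrullDim_eq_ringKrullDim, MatroidStrata.card_newVar] at h1
    exact h1
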